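/- Let $d\ge 1$ be an integer and let $p,\gamma$ be real numbers with $1\le p<+\infty$ and $-1<\gamma<p-1$. Write points of $\mathbb{R}^{d+1}$ as $(x,t)$ with $x\in\mathbb{R}^d$, $t\in\mathbb{R}$, and let $\mathbb{R}^{d+1}_+=\{(x,t): t>0\}$. For an open set $\Omega\subseteq\mathbb{R}^{d+1}$, a $1$-form $A=(A_1,\dots,A_{d+1})\in C^1(\mathbb{R}^{d+1},\bigwedge^1\mathbb{R}^{d+1})$ and $U\in W^{1,1}_{\mathrm{loc}}(\Omega,\mathbb{C})$, let $\nabla_A U=\nabla U+iAU$ be the weak covariant gradient, and let $$W^{1,p}_{A,\gamma}(\Omega)=\Bigl\{U\in W^{1,1}_{\mathrm{loc}}(\Omega,\mathbb{C})\;;\;\iint_{\Omega}\bigl(|\nabla_A U(x,t)|^p+|U(x,t)|^p\bigr)\,|t|^\gamma\,\mathrm{d}x\,\mathrm{d}t<+\infty\Bigr\}.$$ Let $dA$ be the exterior derivative of $A$ and $\|dA\|_{L^\infty}=\sup_{X\in\mathbb{R}^{d+1}}\sup_{|v|,|w|\le 1}|dA(X)[v,w]|$. There exists a constant $C>0$,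 depending only on $d$, $p$ and $\gamma$, such that for every $A\in C^1(\mathbb{R}^{d+1},\bigwedge^1\mathbb{R}^{d+1})$ with $dA$ bounded and every $U\in W^{1,p}_{A,\gamma}(\mathbb{R}^{d+1}_+)$ there exists $\bar U\in W^{1,p}_{A,\gamma}(\mathbb{R}^{d+1})$ such that $\bar U=U$ on $\mathbb{R}^{d+1}_+$ and such that, for every $\beta\ge\|dA\|_{L^\infty}$, $$\iint_{\mathbb{R}^{d+1}}\bigl(|\nabla_A\bar U(x,t)|^p+\beta^{p/2}|\bar U(x,t)|^p\bigr)\,|t|^\gamma\,\mathrm{d}x\,\mathrm{d}t\;\le\;C\iint_{\mathbb{R}^{d+1}_+}\bigl(|\nabla_A U(x,t)|^p+\beta^{p/2}|U(x,t)|^p\bigr)\,t^\gamma\,\mathrm{d}x\,\mathrm{d}t.$$ -/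

import Mathlib

open MeasureTheory Set
open scoped ContDiff ENNReal

noncomputable section

namespace MagneticSobolev

/-- The Euclidean space `ℝ^{d+1}`. A point is written `(x, t)` with `x ∈ ℝ^d` its first `d`
coordinates and `t` its last coordinate. -/
abbrev Space (d : ℕ) : Type := EuclideanSpace ℝ (Fin (d + 1))

/-- The last coordinate `t` of a point `(x, t)` of `ℝ^{d+1}`. -/
def height {d : ℕ} (X : Space d) : ℝ := X (Fin.last d)

/-- The open upper half-space `ℝ^{d+1}_+ = {(x, t) ; t > 0}`. -/
def upperHalfSpace (d : ℕ) : Set (Space d) := {X | 0 < height X}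

/-- The `j`-th vector of the standard basis of `ℝ^{d+1}`. -/
def stdVec {d : ℕ} (j : Fin (d + 1)) : Space d := EuclideanSpace.single j (1 : ℝ)

/-- `ℂ^{d+1}` with the Hermitian norm, in which gradients of complex functions take values. -/
abbrev CVec (d : ℕ) : Type := EuclideanSpace ℂ (Fin (d + 1))

/-- `G` is a weak gradient of `U` on the open set `Ω`: it is locally integrable on `Ω` and
`∫_Ω (∂_j φ) U = - ∫_Ω φ G_j` for each `j` and each smooth `φ` with compact support in `Ω`. -/
def HasWeakGradient {d : ℕ} (Ω : Set (Space d)) (U : Space d → ℂ) (G : Space d → CVec d) : Prop :=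
  LocallyIntegrableOn G Ω ∧
    ∀ φ : Space d → ℝ, ContDiff ℝ ∞ φ → HasCompactSupport φ → tsupport φ ⊆ Ω →
      ∀ j : Fin (d + 1),
        ∫ X in Ω, fderiv ℝ φ X (stdVec j) • U X = - ∫ X in Ω, φ X • G X j

/-- The space `W^{1,1}_loc(Ω, ℂ)`. A function on `Ω` is represented by a function on `ℝ^{d+1}` whose
values outside `Ω` play no role. -/
def MemW11loc {d : ℕ} (Ω : Set (Space d)) (U : Space d → ℂ) : Prop :=
  LocallyIntegrableOn U Ω ∧ ∃ G : Space d → CVec d, HasWeakGradient Ω U G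

open Classical in
/-- The weak gradient `∇U` on `Ω` (unique up to equality almost everywhere on `Ω`, see
`HasWeakGradient.ae_eq`). It is `0` by convention if `U` has no weak gradient on `Ω`. -/
def weakGradient {d : ℕ} (Ω : Set (Space d)) (U : Space d → ℂ) : Space d → CVec d :=
  if h : ∃ G : Space d → CVec d, HasWeakGradient Ω U G then h.choose else 0

/-- The weak covariant gradient `∇_A U = ∇U + i A U` on `Ω`, for a `1`-form `A` on `ℝ^{d+1}`, whose
`j`-th component is `A_j = A[e_j]`. -/
def covGradient {d : ℕ} (A : Space d → Space d [⋀^Fin 1]→L[ℝ] ℝ) (Ω : Set (Space d))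
    (U : Space d → ℂ) (X : Space d) : CVec d :=
  weakGradient Ω U X +
    WithLp.toLp 2 (fun j : Fin (d + 1) => Complex.I * ((A X (fun _ => stdVec j) : ℝ) : ℂ) * U X)

/-- The weighted energy `∫_Ω (|∇_A U|^p + κ |U|^p) |t|^γ dx dt`, with values in `[0, ∞]`. -/
def energy {d : ℕ} (p γ κ : ℝ) (A : Space d → Space d [⋀^Fin 1]→L[ℝ] ℝ) (Ω : Set (Space d))
    (U : Space d → ℂ) : ℝ≥0∞ :=
  ∫⁻ X in Ω,
    ENNReal.ofReal ((‖covGradient A Ω U X‖ ^ p + κ * ‖U X‖ ^ p) * |height X| ^ γ)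

/-- The weighted magnetic Sobolev space `W^{1,p}_{A,γ}(Ω)`: functions of `W^{1,1}_loc(Ω, ℂ)` with
`∫_Ω (|∇_A U|^p + |U|^p) |t|^γ dx dt < ∞`. -/
def MemMagneticSobolev {d : ℕ} (p γ : ℝ) (A : Space d → Space d [⋀^Fin 1]→L[ℝ] ℝ)
    (Ω : Set (Space d)) (U : Space d → ℂ) : Prop :=
  MemW11loc Ω U ∧ energy p γ 1 A Ω U < ⊤

/-- Two weak gradients of the same function agree almost everywhere. -/
theorem HasWeakGradient.ae_eq {d : ℕ} {Ω : Set (Space d)} (hΩ : IsOpen Ω) {U : Space d → ℂ}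
    {G H : Space d → CVec d} (hG : HasWeakGradient Ω U G) (hH : HasWeakGradient Ω U H) :
    ∀ᵐ X ∂(volume.restrict Ω), G X = H X := by
  have comp : ∀ {K : Space d → CVec d}, LocallyIntegrableOn K Ω → ∀ j : Fin (d + 1),
      LocallyIntegrableOn (fun X => K X j) Ω := by
    intro K hK j X hX
    obtain ⟨s, hs, hi⟩ := hK X hX
    exact ⟨s, hs, (EuclideanSpace.proj (𝕜 := ℂ) j).integrable_comp hi⟩
  have key : ∀ j : Fin (d + 1), ∀ᵐ X ∂(volume : Measure (Space d)), X ∈ Ω → G X j - H X j = 0 := by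
    intro j
    refine hΩ.ae_eq_zero_of_integral_contDiff_smul_eq_zero
      ((comp hG.1 j).sub (comp hH.1 j)) ?_
    intro φ hφ hc hs
    have int : ∀ {K : Space d → CVec d}, LocallyIntegrableOn K Ω →
        IntegrableOn (fun X => φ X • K X j) Ω := by
      intro K hK
      have h1 : IntegrableOn (fun X => K X j) (tsupport φ) :=
        (comp hK j).integrableOn_compact_subset hs hc
      have h2 : IntegrableOn (fun X => φ X • K X j) (tsupport φ) :=
        h1.continuousOn_smul hφ.continuous.continuousOn hc
      refine ((integrableOn_iff_integrable_of_support_subset ?_).1 h2).integrableOn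
      intro X hX
      exact subset_tsupport φ (left_ne_zero_of_smul hX)
    have e := (hG.2 φ hφ hc hs j).symm.trans (hH.2 φ hφ hc hs j)
    have z : ∫ X in Ω, φ X • (G X j - H X j) = 0 := by
      simp only [smul_sub]
      rw [integral_sub (int hG.1) (int hH.1), neg_injective e, sub_self]
    rw [← z]
    refine (setIntegral_eq_integral_of_forall_compl_eq_zero ?_).symm
    intro X hX
    have : φ X = 0 := by
      by_contra h
      exact hX (hs (subset_tsupport φ h))
    simp [this]
  rw [ae_restrict_iff' hΩ.measurableSet]
  filter_upwards [ae_all_iff.2 key] with X hX hXΩ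
  ext j
  exact sub_eq_zero.1 (hX j hXΩ)

end MagneticSobolev

end

noncomputable section

namespace MagneticSobolev

open Filter Topology Convolution Metric

/-! Write `R(x, t) = (x, -t)` and `n` for the last index. The extension is a reflection corrected by
a multiplier: `V(x, -t) = m(x, t) U(x, t)` for `t > 0`, with `m = exp(iθ) / (1 + β₀ t²)`, `θ(x, t) =
∫_{-t}^t A_n(x, s) ds` and `β₀ = ‖dA‖_∞`.

The phase is a change of gauge. A plain reflection pulls `A` back to a form that may be far from
`A`, even when `dA` is small. The phase removes this discrepancy: `∂_n θ = A_n + A_n ∘ R` cancels it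
exactly in the normal direction, and in a tangential direction `j` what remains is `∫_{-t}^t dA[e_j,
e_n] ds`, of size at most `2 β₀ t` (`abs_fderiv_phase_sub_le`). The damping factor absorbs the
growth in `t`, since `2 β₀ t / (1 + β₀ t²) ≤ √β₀`, and its own derivative obeys the same bound.
Hence each component of `∇_A V` at `(x, -t)` is at most the one of `∇_A U` at `(x, t)` plus `2 √β₀
|U|` (`norm_reflected_component_le`). Raised to the power `p`, the error is controlled by `β^{p/2}
|U|^p` for every `β ≥ β₀`, with one and the same `V`.

It remains to see that `V` is weakly differentiable across `t = 0`
(`hasWeakGradient_reflectExtend`). This holds because `m = 1` there, provided `U` and `∇U` are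
integrable up to the boundary. That integrability follows from the finite weighted energy and `γ < p
- 1` (`integrableOn_of_weighted`). -/

/-! ### Mollification: from smooth to `C^1` test functions. -/

theorem HasWeakGradient.locallyIntegrableOn_apply {d : ℕ} {Ω : Set (Space d)} {U : Space d → ℂ}
    {G : Space d → CVec d} (hG : HasWeakGradient Ω U G) (j : Fin (d + 1)) :
    LocallyIntegrableOn (fun X => G X j) Ω := by
  intro X hX
  obtain ⟨s, hs, hi⟩ := hG.1 X hX
  exact ⟨s, hs, (EuclideanSpace.proj (𝕜 := ℂ) j).integrable_comp hi⟩

/-- If `g n → g` uniformly with supports in a fixed compact set on which `F` is integrable, then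
`∫ g n • F → ∫ g • F`. -/
theorem tendsto_setIntegral_smul_of_uniform {d : ℕ} {Ω K : Set (Space d)} (hΩ : MeasurableSet Ω)
    (hKΩ : K ⊆ Ω) {F : Space d → ℂ} (hF : IntegrableOn F K)
    {g : ℕ → Space d → ℝ} {f : Space d → ℝ} (hg : ∀ n, Continuous (g n)) (hf : ∀ X, X ∉ K → f X = 0)
    (hgK : ∀ᶠ n in atTop, ∀ X, X ∉ K → g n X = 0) {C : ℝ} (hC : ∀ X, |f X| ≤ C)
    (h : ∀ ε > 0, ∀ᶠ n in atTop, ∀ X, |g n X - f X| ≤ ε) :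
    Tendsto (fun n => ∫ X in Ω, g n X • F X) atTop (𝓝 (∫ X in Ω, f X • F X)) := by
  have red : ∀ k : Space d → ℝ, (∀ X, X ∉ K → k X = 0) →
      ∫ X in Ω, k X • F X = ∫ X in K, k X • F X := by
    intro k hk
    refine setIntegral_eq_of_subset_of_forall_sdiff_eq_zero hΩ hKΩ ?_
    intro X hX
    rw [hk X hX.2, zero_smul]
  rw [red f hf]
  have e : ∀ᶠ n in atTop, ∫ X in K, g n X • F X = ∫ X in Ω, g n X • F X := by
    filter_upwards [hgK] with n hn using (red _ hn).symm
  refine Tendsto.congr' e ?_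
  refine tendsto_integral_filter_of_dominated_convergence (fun X => (C + 1) * ‖F X‖) ?_ ?_ ?_ ?_
  · exact Eventually.of_forall fun n => (hg n).aestronglyMeasurable.smul hF.aestronglyMeasurable
  · filter_upwards [h 1 one_pos] with n hn
    refine Eventually.of_forall fun X => ?_
    rw [norm_smul, Real.norm_eq_abs]
    gcongr
    have := abs_sub_abs_le_abs_sub (g n X) (f X)
    linarith [hn X, hC X]
  · exact hF.norm.const_mul _
  · refine Eventually.of_forall fun X => ?_
    refine Tendsto.smul_const ?_ _
    rw [Metric.tendsto_nhds]
    intro ε hε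
    filter_upwards [h (ε / 2) (half_pos hε)] with n hn
    rw [Real.dist_eq]
    linarith [hn X]

/-- A sequence of bump functions at the origin with radii tending to zero. -/
def shrinkingBump (d : ℕ) (n : ℕ) : ContDiffBump (0 : Space d) where
  rIn := 1 / (2 * ((n : ℝ) + 1))
  rOut := 1 / ((n : ℝ) + 1)
  rIn_pos := by positivity
  rIn_lt_rOut := by
    apply one_div_lt_one_div_of_lt <;> linarith [(Nat.cast_nonneg n : (0 : ℝ) ≤ n)]

theorem tendsto_shrinkingBump_rOut (d : ℕ) :
    Tendsto (fun n => (shrinkingBump d n).rOut) atTop (𝓝 0) :=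
  tendsto_one_div_add_atTop_nhds_zero_nat

/-- Mollification of a continuous compactly supported function converges uniformly. -/
theorem eventually_mollify_sub_le {d : ℕ} {f : Space d → ℝ} (hf : Continuous f)
    (hc : HasCompactSupport f) {ε : ℝ} (hε : 0 < ε) :
    ∀ᶠ n in atTop, ∀ X,
      |((shrinkingBump d n).normed volume ⋆[ContinuousLinearMap.lsmul ℝ ℝ, volume] f) X - f X| ≤
        ε := by
  have hu := hc.uniformContinuous_of_continuous hf
  obtain ⟨δ, hδ, h⟩ := Metric.uniformContinuous_iff.1 hu ε hε
  filter_upwards [(tendsto_shrinkingBump_rOut d).eventually (gt_mem_nhds hδ)] with n hn X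
  rw [← Real.dist_eq]
  refine (shrinkingBump d n).dist_normed_convolution_le hf.aestronglyMeasurable ?_
  intro Y hY
  exact (h ((mem_ball.1 hY).trans hn)).le

theorem mollify_eq_zero {d : ℕ} {f : Space d → ℝ} {S : Set (Space d)} (hS : Function.support f ⊆ S)
    {δ : ℝ} {n : ℕ} (hn : (shrinkingBump d n).rOut ≤ δ) {X : Space d}
    (hX : X ∉ cthickening δ S) :
    ((shrinkingBump d n).normed volume ⋆[ContinuousLinearMap.lsmul ℝ ℝ, volume] f) X = 0 := by
  by_contra hne
  apply hX
  obtain ⟨a, ha, b, hb, rfl⟩ :=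
    support_convolution_subset (ContinuousLinearMap.lsmul ℝ ℝ) (Function.mem_support.2 hne)
  rw [ContDiffBump.support_normed_eq, mem_ball, dist_zero_right] at ha
  refine mem_cthickening_of_dist_le _ b _ _ (hS hb) ?_
  simpa using ha.le.trans hn

/-- A weak gradient can be tested against continuously differentiable functions. -/
theorem HasWeakGradient.integral_fderiv_smul {d : ℕ} {Ω : Set (Space d)} (hΩ : IsOpen Ω)
    {U : Space d → ℂ} {G : Space d → CVec d} (hU : LocallyIntegrableOn U Ω)
    (hG : HasWeakGradient Ω U G) {ψ : Space d → ℝ} (hψ : ContDiff ℝ 1 ψ)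
    (hc : HasCompactSupport ψ) (hs : tsupport ψ ⊆ Ω) (j : Fin (d + 1)) :
    ∫ X in Ω, fderiv ℝ ψ X (stdVec j) • U X = - ∫ X in Ω, ψ X • G X j := by
  -- The compact thickening `K` inside `Ω` contains the supports of all mollifications of radius at
  -- most `δ`.
  obtain ⟨δ, hδ, hK⟩ := hc.isCompact.exists_cthickening_subset_open hΩ hs
  set K := cthickening δ (tsupport ψ) with hKdef
  have hKc : IsCompact K := hc.isCompact.cthickening
  let ψn : ℕ → Space d → ℝ := fun n =>
    (shrinkingBump d n).normed volume ⋆[ContinuousLinearMap.lsmul ℝ ℝ, volume] ψ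
  let D : Space d → ℝ := fun X => fderiv ℝ ψ X (stdVec j)
  have hDc : Continuous D := (hψ.continuous_fderiv one_ne_zero).clm_apply continuous_const
  have hDcs : HasCompactSupport D := hc.fderiv_apply ℝ (stdVec j)
  have hsmooth : ∀ n, ContDiff ℝ ∞ (ψn n) := fun n =>
    (shrinkingBump d n).hasCompactSupport_normed.contDiff_convolution_left _
      (shrinkingBump d n).contDiff_normed hψ.continuous.locallyIntegrable
  -- The derivative falls on `ψ`, so the derivatives of the mollifications are mollifications of `D`
  -- and converge uniformly too.
  have hder : ∀ n X, fderiv ℝ (ψn n) X (stdVec j) =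
      ((shrinkingBump d n).normed volume ⋆[ContinuousLinearMap.lsmul ℝ ℝ, volume] D) X := by
    intro n X
    have h1 := hc.hasFDerivAt_convolution_right (ContinuousLinearMap.lsmul ℝ ℝ) (μ := volume)
      ((shrinkingBump d n).continuous_normed (μ := volume)).locallyIntegrable hψ X
    rw [h1.fderiv]
    exact convolution_precompR_apply _
      ((shrinkingBump d n).continuous_normed (μ := volume)).locallyIntegrable (hc.fderiv ℝ)
      (hψ.continuous_fderiv one_ne_zero) X (stdVec j)
  have hout : ∀ᶠ n in atTop, (shrinkingBump d n).rOut ≤ δ := by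
    filter_upwards [(tendsto_shrinkingBump_rOut d).eventually (gt_mem_nhds hδ)] with n hn
      using le_of_lt hn
  have hsD : Function.support D ⊆ tsupport ψ := by
    intro X hX
    by_contra h
    exact hX (by simp [D, fderiv_of_notMem_tsupport (𝕜 := ℝ) h])
  have hz : ∀ {f : Space d → ℝ}, Function.support f ⊆ tsupport ψ → ∀ X, X ∉ K → f X = 0 := by
    intro f hf X hX
    by_contra h
    exact hX (self_subset_cthickening _ (hf h))
  obtain ⟨C1, hC1⟩ := hψ.continuous.bounded_above_of_compact_support hc
  obtain ⟨C2, hC2⟩ := hDc.bounded_above_of_compact_support hDcs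
  have l1 := tendsto_setIntegral_smul_of_uniform hΩ.measurableSet hK
    (hU.integrableOn_compact_subset hK hKc) (g := fun n X => fderiv ℝ (ψn n) X (stdVec j)) (f := D)
    (fun n => ((hsmooth n).continuous_fderiv (by simp)).clm_apply continuous_const)
    (hz hsD)
    (by
      filter_upwards [hout] with n hn X hX
      rw [hder]
      exact mollify_eq_zero hsD hn hX)
    hC2
    (by
      intro ε hε
      filter_upwards [eventually_mollify_sub_le hDc hDcs hε] with n hn X
      rw [hder]
      exact hn X)
  have l2 := tendsto_setIntegral_smul_of_uniform hΩ.measurableSet hK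
    ((hG.locallyIntegrableOn_apply j).integrableOn_compact_subset hK hKc) (g := ψn) (f := ψ)
    (fun n => (hsmooth n).continuous) (hz (subset_tsupport ψ))
    (by
      filter_upwards [hout] with n hn X hX
      exact mollify_eq_zero (subset_tsupport ψ) hn hX)
    hC1 (fun ε hε => eventually_mollify_sub_le hψ.continuous hc hε)
  refine tendsto_nhds_unique (l1.congr' ?_) l2.neg
  filter_upwards [hout] with n hn
  have hsub : tsupport (ψn n) ⊆ K := by
    refine closure_minimal ?_ hKc.isClosed
    intro X hX
    by_contra h
    exact hX (mollify_eq_zero (subset_tsupport ψ) hn h)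
  exact hG.2 (ψn n) (hsmooth n) (HasCompactSupport.intro hKc fun X hX => by
    by_contra h
    exact hX (hsub (subset_tsupport _ h))) (hsub.trans hK) j

/-! ### Test functions reaching the boundary of the half-space. -/

/-- The last coordinate as a continuous linear form. -/
def heightL (d : ℕ) : Space d →L[ℝ] ℝ := EuclideanSpace.proj (Fin.last d)

theorem heightL_apply {d : ℕ} (X : Space d) : heightL d X = height X := rfl

theorem continuous_height {d : ℕ} : Continuous (height : Space d → ℝ) := (heightL d).continuous

theorem height_stdVec {d : ℕ} (j : Fin (d + 1)) :
    height (stdVec j : Space d) = if j = Fin.last d then 1 else 0 := by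
  simp [height, stdVec, eq_comm]

theorem isOpen_upperHalfSpace (d : ℕ) : IsOpen (upperHalfSpace d) :=
  isOpen_lt continuous_const continuous_height

/-- With `r = (n + 1) t`, this bounds `t` times the normal derivative of the boundary cutoff,
uniformly in `n`. The derivative of the transition lives on `1 ≤ r ≤ 2`. -/
theorem exists_bound_mul_deriv_smoothTransition :
    ∃ K : ℝ, 0 ≤ K ∧ ∀ r : ℝ, |r * deriv Real.smoothTransition (r - 1)| ≤ K := by
  have hc : Continuous fun r : ℝ => r * deriv Real.smoothTransition (r - 1) := by
    have h : Continuous (deriv Real.smoothTransition) :=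
      (Real.smoothTransition.contDiff (n := 1)).continuous_deriv le_rfl
    fun_prop
  obtain ⟨K, hK⟩ := hc.bounded_above_of_compact_support
    (HasCompactSupport.intro (isCompact_Icc (a := (1 : ℝ)) (b := 2)) (by
      intro r hr
      have : deriv Real.smoothTransition (r - 1) = 0 := by
        rcases lt_or_ge r 1 with h | h
        · have : Real.smoothTransition =ᶠ[𝓝 (r - 1)] fun _ => 0 := by
            filter_upwards [gt_mem_nhds (show r - 1 < 0 by linarith)] with s hs
            exact Real.smoothTransition.zero_of_nonpos hs.le
          rw [this.deriv_eq, deriv_const]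
        · have h2 : 2 < r := by
            by_contra h'
            exact hr ⟨h, not_lt.1 h'⟩
          have : Real.smoothTransition =ᶠ[𝓝 (r - 1)] fun _ => 1 := by
            filter_upwards [lt_mem_nhds (show 1 < r - 1 by linarith)] with s hs
            exact Real.smoothTransition.one_of_one_le hs.le
          rw [this.deriv_eq, deriv_const]
      rw [this, mul_zero]))
  exact ⟨K, (norm_nonneg _).trans (hK 0), hK⟩

/-- A cutoff which vanishes near the boundary hyperplane and tends to `1` on the half-space. -/
def boundaryCutoff (d n : ℕ) (X : Space d) : ℝ :=
  Real.smoothTransition (((n : ℝ) + 1) * height X - 1)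

theorem contDiff_boundaryCutoff (d n : ℕ) : ContDiff ℝ 1 (boundaryCutoff d n) := by
  have h : ContDiff ℝ 1 (fun X : Space d => height X) := (heightL d).contDiff
  exact Real.smoothTransition.contDiff.comp ((contDiff_const.mul h).sub contDiff_const)

theorem fderiv_boundaryCutoff (d n : ℕ) (X Y : Space d) :
    fderiv ℝ (boundaryCutoff d n) X Y =
      deriv Real.smoothTransition (((n : ℝ) + 1) * height X - 1) * (((n : ℝ) + 1) * height Y) := by
  have h1 : HasFDerivAt (fun X : Space d => ((n : ℝ) + 1) * height X - 1)
      (((n : ℝ) + 1) • heightL d) X := ((heightL d).hasFDerivAt.const_mul _).sub_const _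
  have h2 : HasDerivAt Real.smoothTransition
      (deriv Real.smoothTransition (((n : ℝ) + 1) * height X - 1))
      (((n : ℝ) + 1) * height X - 1) :=
    ((Real.smoothTransition.contDiff (n := 1)).differentiable one_ne_zero _).hasDerivAt
  have h3 := (h2.comp_hasFDerivAt X h1).fderiv
  change fderiv ℝ (Real.smoothTransition ∘ _) X Y = _
  rw [h3]
  rfl

theorem boundaryCutoff_mem_Icc (d n : ℕ) (X : Space d) : boundaryCutoff d n X ∈ Icc (0 : ℝ) 1 :=
  ⟨Real.smoothTransition.nonneg _, Real.smoothTransition.le_one _⟩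

theorem eventually_boundaryCutoff {d : ℕ} {X : Space d} (hX : 0 < height X) :
    ∀ᶠ n in atTop, boundaryCutoff d n X = 1 ∧ fderiv ℝ (boundaryCutoff d n) X = 0 := by
  have ht : Tendsto (fun n : ℕ => ((n : ℝ) + 1) * height X) atTop atTop :=
    (tendsto_atTop_add_const_right _ _ tendsto_natCast_atTop_atTop).atTop_mul_const hX
  filter_upwards [ht.eventually_gt_atTop 2] with n hn
  have hev : boundaryCutoff d n =ᶠ[𝓝 X] fun _ => 1 := by
    have hc : ContinuousAt (fun Y : Space d => ((n : ℝ) + 1) * height Y) X :=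
      (continuous_const.mul continuous_height).continuousAt
    filter_upwards [hc.eventually (lt_mem_nhds hn)] with Y hY
    exact Real.smoothTransition.one_of_one_le (by linarith)
  exact ⟨hev.self_of_nhds, by rw [hev.fderiv_eq, fderiv_fun_const]; rfl⟩

/-- A function that is Lipschitz and vanishes on the boundary hyperplane is at most linear in the
height. -/
theorem abs_le_mul_abs_height {d : ℕ} {ψ : Space d → ℝ} {L : NNReal} (hL : LipschitzWith L ψ)
    (h0 : ∀ X, height X = 0 → ψ X = 0) (X : Space d) : |ψ X| ≤ L * |height X| := by
  have h1 : height (X - height X • stdVec (Fin.last d)) = 0 := by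
    rw [← heightL_apply (X - _), map_sub, map_smul, heightL_apply, heightL_apply, height_stdVec]
    simp
  have h2 := hL.dist_le_mul X (X - height X • stdVec (Fin.last d))
  rw [h0 _ h1, dist_zero_right, Real.norm_eq_abs, dist_eq_norm, sub_sub_cancel, norm_smul] at h2
  simpa [stdVec] using h2

/-- On the half-space, a weak gradient which is integrable up to the boundary can be tested against
continuously differentiable functions which, for the normal derivative, vanish on the boundary. -/
theorem HasWeakGradient.integral_upperHalfSpace {d : ℕ} {U : Space d → ℂ} {G : Space d → CVec d}
    (hUl : LocallyIntegrableOn U (upperHalfSpace d)) (hG : HasWeakGradient (upperHalfSpace d) U G)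
    (hU : ∀ R, IntegrableOn U (upperHalfSpace d ∩ closedBall 0 R))
    (hGi : ∀ R, IntegrableOn G (upperHalfSpace d ∩ closedBall 0 R))
    {ψ : Space d → ℝ} (hψ : ContDiff ℝ 1 ψ) (hc : HasCompactSupport ψ) (j : Fin (d + 1))
    (h0 : j = Fin.last d → ∀ X, height X = 0 → ψ X = 0) :
    ∫ X in upperHalfSpace d, fderiv ℝ ψ X (stdVec j) • U X =
      - ∫ X in upperHalfSpace d, ψ X • G X j := by
  obtain ⟨R, hR⟩ := hc.isCompact.isBounded.subset_closedBall 0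
  have hH := (isOpen_upperHalfSpace d).measurableSet
  have hGj : IntegrableOn (fun X => G X j) (upperHalfSpace d ∩ closedBall 0 R) :=
    (EuclideanSpace.proj (𝕜 := ℂ) j).integrable_comp (hGi R)
  have hψ0 : ∀ X, X ∉ closedBall (0 : Space d) R → ψ X = 0 := fun X hX =>
    image_eq_zero_of_notMem_tsupport fun h => hX (hR h)
  have hdψ0 : ∀ X, X ∉ closedBall (0 : Space d) R → fderiv ℝ ψ X = 0 := fun X hX =>
    fderiv_of_notMem_tsupport (𝕜 := ℝ) fun h => hX (hR h)
  have red : ∀ (k : Space d → ℝ) (F : Space d → ℂ), (∀ X, X ∉ closedBall (0 : Space d) R → k X = 0) →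
      ∫ X in upperHalfSpace d, k X • F X =
        ∫ X in upperHalfSpace d ∩ closedBall 0 R, k X • F X := by
    intro k F hk
    refine setIntegral_eq_of_subset_of_forall_sdiff_eq_zero hH inter_subset_left ?_
    intro X hX
    rw [hk X fun h => hX.2 ⟨hX.1, h⟩, zero_smul]
  let ψn : ℕ → Space d → ℝ := fun n X => boundaryCutoff d n X * ψ X
  have hψn : ∀ n, ContDiff ℝ 1 (ψn n) := fun n => (contDiff_boundaryCutoff d n).mul hψ
  have hder : ∀ n X, fderiv ℝ (ψn n) X (stdVec j) =
      boundaryCutoff d n X * fderiv ℝ ψ X (stdVec j) +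
        ψ X * fderiv ℝ (boundaryCutoff d n) X (stdVec j) := by
    intro n X
    have := fderiv_mul ((contDiff_boundaryCutoff d n).differentiable one_ne_zero X)
      (hψ.differentiable one_ne_zero X)
    change fderiv ℝ (boundaryCutoff d n * ψ) X (stdVec j) = _
    rw [this]
    rfl
  have hid : ∀ n, ∫ X in upperHalfSpace d, fderiv ℝ (ψn n) X (stdVec j) • U X =
      - ∫ X in upperHalfSpace d, ψn n X • G X j := by
    intro n
    have hcn : HasCompactSupport (ψn n) := hc.mul_left
    refine hG.integral_fderiv_smul (isOpen_upperHalfSpace d) hUl (hψn n) hcn ?_ j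
    -- The cutoff vanishes for `t ≤ 1 / (n + 1)`, so `ψn n` is an admissible test function in the
    -- open half-space.
    have h1 : tsupport (ψn n) ⊆ {X | 1 ≤ ((n : ℝ) + 1) * height X} := by
      refine closure_minimal ?_ (isClosed_le continuous_const
        (continuous_const.mul continuous_height))
      intro X hX
      by_contra h
      apply hX
      have : boundaryCutoff d n X = 0 :=
        Real.smoothTransition.zero_of_nonpos (by simp only [mem_ofPred_eq, not_le] at h; linarith)
      simp [ψn, this]
    intro X hX
    have h2 : 1 ≤ ((n : ℝ) + 1) * height X := h1 hX
    exact pos_of_mul_pos_right (one_pos.trans_le h2) (by positivity)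
  obtain ⟨C1, hC1⟩ := hψ.continuous.bounded_above_of_compact_support hc
  obtain ⟨C2, hC2⟩ := ((hψ.continuous_fderiv one_ne_zero).clm_apply
    continuous_const).bounded_above_of_compact_support (hc.fderiv_apply ℝ (stdVec j))
  obtain ⟨K, hK0, hK⟩ := exists_bound_mul_deriv_smoothTransition
  obtain ⟨L, hL⟩ := hψ.lipschitzWith_of_hasCompactSupport hc one_ne_zero
  -- The cutoff has a normal derivative of order `n` near the boundary, but there `|ψ| ≤ L t`, so
  -- the product stays bounded and dominated convergence applies. Its tangential derivatives vanish,
  -- hence no boundary condition is needed for `j ≠ Fin.last d`.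
  have hcut : ∀ n X, X ∈ upperHalfSpace d →
      |ψ X * fderiv ℝ (boundaryCutoff d n) X (stdVec j)| ≤ L * K := by
    intro n X hX
    rw [fderiv_boundaryCutoff, height_stdVec]
    split_ifs with hj
    · have h1 := abs_le_mul_abs_height hL (h0 hj) X
      have h2 := hK (((n : ℝ) + 1) * height X)
      rw [abs_mul, abs_mul, abs_of_nonneg (show (0 : ℝ) ≤ (n : ℝ) + 1 by positivity)] at h2
      rw [mul_one, abs_mul, abs_mul, abs_of_nonneg (show (0 : ℝ) ≤ (n : ℝ) + 1 by positivity)]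
      calc |ψ X| * (|deriv Real.smoothTransition (((n : ℝ) + 1) * height X - 1)| * ((n : ℝ) + 1))
          ≤ (L * |height X|) *
            (|deriv Real.smoothTransition (((n : ℝ) + 1) * height X - 1)| * ((n : ℝ) + 1)) := by
            gcongr
        _ = L * (((n : ℝ) + 1) * |height X| *
            |deriv Real.smoothTransition (((n : ℝ) + 1) * height X - 1)|) := by ring
        _ ≤ L * K := by gcongr
    · simp only [mul_zero, abs_zero]
      positivity
  have l1 : Tendsto (fun n => ∫ X in upperHalfSpace d, fderiv ℝ (ψn n) X (stdVec j) • U X) atTop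
      (𝓝 (∫ X in upperHalfSpace d, fderiv ℝ ψ X (stdVec j) • U X)) := by
    rw [red _ U fun X hX => by rw [hdψ0 X hX]; rfl]
    simp_rw [fun n => red (fun X => fderiv ℝ (ψn n) X (stdVec j)) U fun X hX => by
      rw [hder, hψ0 X hX, hdψ0 X hX]; simp]
    refine tendsto_integral_of_dominated_convergence (fun X => (C2 + L * K) * ‖U X‖) ?_
      ((hU R).norm.const_mul _) ?_ ?_
    · exact fun n => (((hψn n).continuous_fderiv one_ne_zero).clm_apply
        continuous_const).aestronglyMeasurable.smul (hU R).aestronglyMeasurable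
    · intro n
      refine (ae_restrict_mem (hH.inter measurableSet_closedBall)).mono fun X hX => ?_
      rw [norm_smul, hder]
      gcongr
      refine (norm_add_le _ _).trans (add_le_add ?_ (hcut n X hX.1))
      rw [norm_mul, Real.norm_of_nonneg (boundaryCutoff_mem_Icc d n X).1]
      exact (mul_le_of_le_one_left (norm_nonneg _) (boundaryCutoff_mem_Icc d n X).2).trans (hC2 X)
    · refine (ae_restrict_mem (hH.inter measurableSet_closedBall)).mono fun X hX => ?_
      refine tendsto_const_nhds.congr' ?_
      filter_upwards [eventually_boundaryCutoff hX.1] with n hn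
      rw [hder, hn.1, hn.2]
      simp
  have l2 : Tendsto (fun n => ∫ X in upperHalfSpace d, ψn n X • G X j) atTop
      (𝓝 (∫ X in upperHalfSpace d, ψ X • G X j)) := by
    rw [red _ _ hψ0]
    simp_rw [fun n => red (ψn n) (fun X => G X j) fun X hX => by simp [ψn, hψ0 X hX]]
    refine tendsto_integral_of_dominated_convergence (fun X => C1 * ‖G X j‖) ?_
      (hGj.norm.const_mul _) ?_ ?_
    · exact fun n => (hψn n).continuous.aestronglyMeasurable.smul hGj.aestronglyMeasurable
    · refine fun n => Eventually.of_forall fun X => ?_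
      rw [norm_smul, norm_mul, Real.norm_of_nonneg (boundaryCutoff_mem_Icc d n X).1]
      gcongr
      exact (mul_le_of_le_one_left (norm_nonneg _) (boundaryCutoff_mem_Icc d n X).2).trans (hC1 X)
    · refine (ae_restrict_mem (hH.inter measurableSet_closedBall)).mono fun X hX => ?_
      refine tendsto_const_nhds.congr' ?_
      filter_upwards [eventually_boundaryCutoff hX.1] with n hn
      simp [ψn, hn.1]
  exact tendsto_nhds_unique (l1.congr hid) l2.neg

/-- The product of a continuous compactly supported function with a function which is integrable up
to the boundary is integrable on the half-space. -/
theorem integrableOn_upperHalfSpace_smul {d : ℕ} {𝕜 : Type*} [RCLike 𝕜] [NormedSpace 𝕜 ℂ]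
    {k : Space d → 𝕜} {F : Space d → ℂ} (hk : Continuous k) (hc : HasCompactSupport k)
    (hF : ∀ R, IntegrableOn F (upperHalfSpace d ∩ closedBall 0 R)) :
    IntegrableOn (fun X => k X • F X) (upperHalfSpace d) := by
  obtain ⟨R, hR⟩ := hc.isCompact.isBounded.subset_closedBall 0
  obtain ⟨C, hC⟩ := hk.bounded_above_of_compact_support hc
  have h1 : IntegrableOn (fun X => k X • F X) (upperHalfSpace d ∩ closedBall 0 R) :=
    Integrable.bdd_smul (hF R) C hk.aestronglyMeasurable (Eventually.of_forall hC)
  refine h1.of_forall_sdiff_eq_zero (isOpen_upperHalfSpace d).measurableSet ?_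
  intro X hX
  rw [image_eq_zero_of_notMem_tsupport fun h => hX.2 ⟨hX.1, hR h⟩, zero_smul]

/-- Complex-valued test functions on the half-space. -/
theorem HasWeakGradient.integral_upperHalfSpace_mul {d : ℕ} {U : Space d → ℂ}
    {G : Space d → CVec d} (hUl : LocallyIntegrableOn U (upperHalfSpace d))
    (hG : HasWeakGradient (upperHalfSpace d) U G)
    (hU : ∀ R, IntegrableOn U (upperHalfSpace d ∩ closedBall 0 R))
    (hGi : ∀ R, IntegrableOn G (upperHalfSpace d ∩ closedBall 0 R))
    {ψ : Space d → ℂ} (hψ : ContDiff ℝ 1 ψ) (hc : HasCompactSupport ψ) (j : Fin (d + 1))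
    (h0 : j = Fin.last d → ∀ X, height X = 0 → ψ X = 0) :
    ∫ X in upperHalfSpace d, fderiv ℝ ψ X (stdVec j) * U X =
      - ∫ X in upperHalfSpace d, ψ X * G X j := by
  have hGj : ∀ R, IntegrableOn (fun X => G X j) (upperHalfSpace d ∩ closedBall 0 R) := fun R =>
    (EuclideanSpace.proj (𝕜 := ℂ) j).integrable_comp (hGi R)
  have hre : ContDiff ℝ 1 fun X => (ψ X).re := Complex.reCLM.contDiff.comp hψ
  have him : ContDiff ℝ 1 fun X => (ψ X).im := Complex.imCLM.contDiff.comp hψ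
  have hcre : HasCompactSupport fun X => (ψ X).re := hc.comp_left (g := Complex.re) rfl
  have hcim : HasCompactSupport fun X => (ψ X).im := hc.comp_left (g := Complex.im) rfl
  have ere := hG.integral_upperHalfSpace hUl hU hGi hre hcre j fun h X hX => by simp [h0 h X hX]
  have eim := hG.integral_upperHalfSpace hUl hU hGi him hcim j fun h X hX => by simp [h0 h X hX]
  have dre : ∀ X, fderiv ℝ (fun X => (ψ X).re) X (stdVec j) = (fderiv ℝ ψ X (stdVec j)).re :=
    fun X => by
      have := (Complex.reCLM.hasFDerivAt.comp X (hψ.differentiable one_ne_zero X).hasFDerivAt)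
      exact congrArg (fun l => l (stdVec j)) this.fderiv
  have dim : ∀ X, fderiv ℝ (fun X => (ψ X).im) X (stdVec j) = (fderiv ℝ ψ X (stdVec j)).im :=
    fun X => by
      have := (Complex.imCLM.hasFDerivAt.comp X (hψ.differentiable one_ne_zero X).hasFDerivAt)
      exact congrArg (fun l => l (stdVec j)) this.fderiv
  simp_rw [dre] at ere
  simp_rw [dim] at eim
  have split : ∀ (k F : Space d → ℂ), Continuous k → HasCompactSupport k →
      (∀ R, IntegrableOn F (upperHalfSpace d ∩ closedBall 0 R)) →
      ∫ X in upperHalfSpace d, k X * F X = (∫ X in upperHalfSpace d, (k X).re • F X) +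
        Complex.I * ∫ X in upperHalfSpace d, (k X).im • F X := by
    intro k F hk hkc hF
    have h1 := integrableOn_upperHalfSpace_smul (Complex.continuous_re.comp hk)
      (hkc.comp_left (g := Complex.re) rfl) hF
    have h2 := integrableOn_upperHalfSpace_smul (Complex.continuous_im.comp hk)
      (hkc.comp_left (g := Complex.im) rfl) hF
    simp only [Function.comp_apply] at h1 h2
    rw [← integral_const_mul, ← integral_add h1 (h2.const_mul _)]
    refine integral_congr_ae (Eventually.of_forall fun X => ?_)
    simp only [Complex.real_smul]
    nth_rw 1 [← Complex.re_add_im (k X)]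
    ring
  rw [split _ U ((hψ.continuous_fderiv one_ne_zero).clm_apply continuous_const)
    (hc.fderiv_apply ℝ (stdVec j)) hU, split ψ _ hψ.continuous hc hGj, ere, eim]
  ring

/-! ### The reflection and the folding of integrals onto the half-space. -/

/-- The sign by which the reflection acts on the `j`-th coordinate. -/
def reflectSign {d : ℕ} (j : Fin (d + 1)) : ℝ := if j = Fin.last d then -1 else 1

theorem reflectSign_mul_self {d : ℕ} (j : Fin (d + 1)) : reflectSign j * reflectSign j = 1 := by
  unfold reflectSign; split_ifs <;> norm_num

theorem abs_reflectSign {d : ℕ} (j : Fin (d + 1)) : |reflectSign j| = 1 := by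
  unfold reflectSign; split_ifs <;> norm_num

/-- The reflection `(x, t) ↦ (x, -t)`. -/
def reflect (d : ℕ) : Space d ≃ₗᵢ[ℝ] Space d :=
  LinearIsometryEquiv.piLpCongrRight 2 fun j : Fin (d + 1) =>
    if j = Fin.last d then LinearIsometryEquiv.neg ℝ else LinearIsometryEquiv.refl ℝ ℝ

theorem reflect_apply {d : ℕ} (X : Space d) (j : Fin (d + 1)) :
    reflect d X j = reflectSign j * X j := by
  simp only [reflect, reflectSign, LinearIsometryEquiv.piLpCongrRight_apply]
  split_ifs <;> simp

theorem reflect_reflect {d : ℕ} (X : Space d) : reflect d (reflect d X) = X := by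
  ext j
  rw [reflect_apply, reflect_apply, ← mul_assoc, reflectSign_mul_self, one_mul]

theorem height_reflect {d : ℕ} (X : Space d) : height (reflect d X) = - height X := by
  simp [height, reflect_apply, reflectSign]

theorem reflect_stdVec {d : ℕ} (j : Fin (d + 1)) :
    reflect d (stdVec j) = reflectSign j • stdVec j := by
  ext k
  rw [reflect_apply]
  by_cases h : k = j
  · subst h; simp [stdVec]
  · simp [stdVec, h]

theorem reflect_eq_self {d : ℕ} {X : Space d} (h : height X = 0) : reflect d X = X := by
  ext k
  rw [reflect_apply, reflectSign]
  split_ifs with hk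
  · subst hk
    rw [show X (Fin.last d) = 0 from h, mul_zero]
  · rw [one_mul]

theorem volume_height_eq_zero (d : ℕ) : volume {X : Space d | height X = 0} = 0 := by
  refine Measure.addHaar_submodule volume (LinearMap.ker (heightL d).toLinearMap) ?_
  intro h
  have : stdVec (Fin.last d) ∈ LinearMap.ker (heightL d).toLinearMap := h ▸ Submodule.mem_top
  have h1 : height (stdVec (Fin.last d) : Space d) = 0 := this
  rw [height_stdVec, if_pos rfl] at h1
  exact one_ne_zero h1

theorem measurableEmbedding_reflect (d : ℕ) : MeasurableEmbedding (reflect d) :=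
  (reflect d).toHomeomorph.measurableEmbedding

/-- The image of the open upper half-space is the open lower one, which differs from the complement
of the upper one by the null hyperplane `t = 0`. -/
theorem measurePreserving_reflect (d : ℕ) :
    MeasurePreserving (reflect d) (volume.restrict (upperHalfSpace d))
      (volume.restrict (upperHalfSpace d)ᶜ) := by
  have h := (LinearIsometryEquiv.measurePreserving (reflect d)).restrict_preimage_emb
    (measurableEmbedding_reflect d) (upperHalfSpace d)ᶜ
  have e : (reflect d ⁻¹' (upperHalfSpace d)ᶜ : Set (Space d)) =ᵐ[volume] upperHalfSpace d := by
    have h0 : ∀ᵐ X : Space d, height X ≠ 0 := by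
      rw [ae_iff]
      simpa using volume_height_eq_zero d
    filter_upwards [h0] with X hX
    refine propext ?_
    change ¬ (0 < height (reflect d X)) ↔ 0 < height X
    rw [height_reflect, Left.neg_pos_iff, not_lt]
    exact ⟨fun h => lt_of_le_of_ne h (Ne.symm hX), le_of_lt⟩
  rwa [Measure.restrict_congr_set e] at h

theorem integral_eq_integral_add_reflect {d : ℕ} {F : Space d → ℂ} (hF : Integrable F) :
    ∫ X, F X = ∫ X in upperHalfSpace d, (F X + F (reflect d X)) := by
  have h1 := (measurePreserving_reflect d).integral_comp (measurableEmbedding_reflect d) F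
  have h2 : IntegrableOn (fun X => F (reflect d X)) (upperHalfSpace d) :=
    ((measurePreserving_reflect d).integrable_comp_emb (measurableEmbedding_reflect d)).2
      hF.integrableOn
  rw [integral_add hF.integrableOn h2, h1,
    integral_add_compl (isOpen_upperHalfSpace d).measurableSet hF]

theorem lintegral_eq_lintegral_add_reflect {d : ℕ} (F : Space d → ℝ≥0∞) :
    ∫⁻ X, F X = (∫⁻ X in upperHalfSpace d, F X) + ∫⁻ X in upperHalfSpace d, F (reflect d X) := by
  rw [(measurePreserving_reflect d).lintegral_comp_emb (measurableEmbedding_reflect d) F,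
    lintegral_add_compl F (isOpen_upperHalfSpace d).measurableSet]

theorem locallyIntegrable_of_reflect {d : ℕ} {E : Type*} [NormedAddCommGroup E] {F : Space d → E}
    (h1 : ∀ R, IntegrableOn F (upperHalfSpace d ∩ closedBall 0 R))
    (h2 : ∀ R, IntegrableOn (fun X => F (reflect d X)) (upperHalfSpace d ∩ closedBall 0 R)) :
    LocallyIntegrable F := by
  have key : ∀ R, IntegrableOn F (closedBall 0 R) := by
    intro R
    have hp := (measurePreserving_reflect d).restrict_preimage_emb
      (measurableEmbedding_reflect d) (closedBall 0 R)
    have hb : (reflect d ⁻¹' closedBall 0 R : Set (Space d)) = closedBall 0 R := by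
      ext X; simp
    rw [hb, Measure.restrict_restrict measurableSet_closedBall,
      Measure.restrict_restrict measurableSet_closedBall] at hp
    have h3 : IntegrableOn F (closedBall 0 R ∩ (upperHalfSpace d)ᶜ) := by
      refine (hp.integrable_comp_emb (measurableEmbedding_reflect d)).1 ?_
      have := h2 R
      rwa [inter_comm] at this
    have h4 := h1 R
    rw [inter_comm] at h4
    have := h4.union h3
    rwa [inter_union_compl] at this
  intro X
  exact ⟨closedBall 0 (‖X‖ + 1), by
    refine mem_of_superset (closedBall_mem_nhds X one_pos) ?_
    intro Y hY
    rw [mem_closedBall] at hY ⊢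
    rw [dist_zero_right]
    linarith [norm_le_norm_add_norm_sub' Y X, dist_eq_norm Y X], key _⟩

/-! ### Weak differentiability of the reflected extension. -/

/-- The extension of `U` from the half-space by reflection and multiplication by `m`. -/
def reflectExtend {d : ℕ} (m U : Space d → ℂ) (X : Space d) : ℂ :=
  if 0 < height X then U X else m (reflect d X) * U (reflect d X)

/-- The gradient of `reflectExtend m U` when `G` is the gradient of `U`. -/
def reflectExtendGrad {d : ℕ} (m U : Space d → ℂ) (G : Space d → CVec d) (X : Space d) : CVec d :=
  if 0 < height X then G X else
    WithLp.toLp 2 fun j => (reflectSign j : ℂ) *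
      (m (reflect d X) * G (reflect d X) j +
        fderiv ℝ m (reflect d X) (stdVec j) * U (reflect d X))

section Extension

variable {d : ℕ} {m U : Space d → ℂ} {G : Space d → CVec d} {X : Space d}

theorem reflectExtend_of_pos (hX : 0 < height X) : reflectExtend m U X = U X := if_pos hX

theorem reflectExtendGrad_of_pos (hX : 0 < height X) : reflectExtendGrad m U G X = G X := if_pos hX

theorem reflectExtend_reflect (hX : 0 < height X) :
    reflectExtend m U (reflect d X) = m X * U X := by
  rw [reflectExtend, if_neg (by rw [height_reflect]; linarith), reflect_reflect]

theorem reflectExtendGrad_reflect (hX : 0 < height X) (j : Fin (d + 1)) :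
    reflectExtendGrad m U G (reflect d X) j =
      (reflectSign j : ℂ) * (m X * G X j + fderiv ℝ m X (stdVec j) * U X) := by
  rw [reflectExtendGrad, if_neg (by rw [height_reflect]; linarith), reflect_reflect]

theorem integrableOn_continuous_mul {S : Set (Space d)} (hS : MeasurableSet S) {k F : Space d → ℂ}
    (hk : Continuous k) {R : ℝ} (hF : IntegrableOn F (S ∩ closedBall 0 R)) :
    IntegrableOn (fun X => k X * F X) (S ∩ closedBall 0 R) := by
  obtain ⟨C, hC⟩ := (isCompact_closedBall (0 : Space d) R).exists_bound_of_continuousOn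
    hk.continuousOn
  refine Integrable.bdd_mul hF hk.aestronglyMeasurable (c := C) ?_
  exact (ae_restrict_mem (hS.inter measurableSet_closedBall)).mono fun X hX => hC X hX.2

theorem locallyIntegrable_reflectExtend (hm : Continuous m)
    (hU : ∀ R, IntegrableOn U (upperHalfSpace d ∩ closedBall 0 R)) :
    LocallyIntegrable (reflectExtend m U) := by
  have hH := (isOpen_upperHalfSpace d).measurableSet
  refine locallyIntegrable_of_reflect (fun R => ?_) fun R => ?_
  · exact (hU R).congr_fun (fun X hX => (reflectExtend_of_pos hX.1).symm)
      (hH.inter measurableSet_closedBall)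
  · exact (integrableOn_continuous_mul hH hm (hU R)).congr_fun
      (fun X hX => (reflectExtend_reflect hX.1).symm) (hH.inter measurableSet_closedBall)

theorem locallyIntegrable_reflectExtendGrad (hm : ContDiff ℝ 1 m)
    (hU : ∀ R, IntegrableOn U (upperHalfSpace d ∩ closedBall 0 R))
    (hG : ∀ R, IntegrableOn G (upperHalfSpace d ∩ closedBall 0 R)) :
    LocallyIntegrable (reflectExtendGrad m U G) := by
  have hH := (isOpen_upperHalfSpace d).measurableSet
  refine locallyIntegrable_of_reflect (fun R => ?_) fun R => ?_
  · exact (hG R).congr_fun (fun X hX => (reflectExtendGrad_of_pos hX.1).symm)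
      (hH.inter measurableSet_closedBall)
  · refine Integrable.of_eval_piLp fun j => ?_
    have h1 := integrableOn_continuous_mul hH hm.continuous
      ((EuclideanSpace.proj (𝕜 := ℂ) j).integrable_comp (hG R))
    have h2 := integrableOn_continuous_mul hH
      ((hm.continuous_fderiv one_ne_zero).clm_apply (continuous_const (y := stdVec j))) (hU R)
    exact IntegrableOn.congr_fun ((h1.add h2).const_mul (reflectSign j : ℂ))
      (fun X hX => (reflectExtendGrad_reflect hX.1 j).symm) (hH.inter measurableSet_closedBall)

/-- The extension by reflection is weakly differentiable if the multiplier is `1` on the boundary. -/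
theorem hasWeakGradient_reflectExtend (hm : ContDiff ℝ 1 m) (hm1 : ∀ X, height X = 0 → m X = 1)
    (hUl : LocallyIntegrableOn U (upperHalfSpace d))
    (hG : HasWeakGradient (upperHalfSpace d) U G)
    (hU : ∀ R, IntegrableOn U (upperHalfSpace d ∩ closedBall 0 R))
    (hGi : ∀ R, IntegrableOn G (upperHalfSpace d ∩ closedBall 0 R)) :
    HasWeakGradient univ (reflectExtend m U) (reflectExtendGrad m U G) := by
  have hH := (isOpen_upperHalfSpace d).measurableSet
  have hVl := locallyIntegrable_reflectExtend hm.continuous hU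
  have hGl := locallyIntegrable_reflectExtendGrad hm hU hGi
  refine ⟨hGl.locallyIntegrableOn _, fun φ hφ hc _ j => ?_⟩
  rw [Measure.restrict_univ]
  have hφ1 : ContDiff ℝ 1 φ := hφ.of_le (by exact_mod_cast le_top)
  set D : Space d → ℝ := fun X => fderiv ℝ φ X (stdVec j) with hD
  have hDc : Continuous D := (hφ1.continuous_fderiv one_ne_zero).clm_apply continuous_const
  have hDs : HasCompactSupport D := hc.fderiv_apply ℝ (stdVec j)
  have hGj : ∀ R, IntegrableOn (fun X => G X j) (upperHalfSpace d ∩ closedBall 0 R) := fun R =>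
    (EuclideanSpace.proj (𝕜 := ℂ) j).integrable_comp (hGi R)
  have hGlj : LocallyIntegrable fun X => reflectExtendGrad m U G X j := by
    intro X
    obtain ⟨s, hs, hi⟩ := hGl X
    exact ⟨s, hs, (EuclideanSpace.proj (𝕜 := ℂ) j).integrable_comp hi⟩
  let φr : Space d → ℂ := fun X => (φ (reflect d X) : ℂ)
  have hφC : ContDiff ℝ 1 fun X => (φ X : ℂ) := Complex.ofRealCLM.contDiff.comp hφ1
  have hφr : ContDiff ℝ 1 φr := hφC.comp (reflect d).contDiff
  have hφCs : HasCompactSupport fun X => (φ X : ℂ) := hc.comp_left (g := Complex.ofReal) rfl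
  have hφrs : HasCompactSupport φr := hφCs.comp_homeomorph (reflect d).toHomeomorph
  -- The part of `∂_j ψ`, for the `ψ` below, in which the derivative hits the multiplier. It
  -- accounts for the `∂_j m` term of `reflectExtendGrad`.
  let b : Space d → ℂ := fun X => φr X * ((reflectSign j : ℂ) * fderiv ℝ m X (stdVec j))
  have hb : Continuous b := hφr.continuous.mul (continuous_const.mul
    ((hm.continuous_fderiv one_ne_zero).clm_apply continuous_const))
  have hbs : HasCompactSupport b := hφrs.mul_right
  -- The test function `φ` folded onto the half-space. The sign compensates the one in `∂_j (φ ∘ R)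
  -- = ± (∂_j φ) ∘ R`.
  let ψ : Space d → ℂ := fun X => (φ X : ℂ) + φr X * ((reflectSign j : ℂ) * m X)
  have hψ : ContDiff ℝ 1 ψ := hφC.add (hφr.mul (contDiff_const.mul hm))
  have hψs : HasCompactSupport ψ := hφCs.add hφrs.mul_right
  have hdψ : ∀ X, fderiv ℝ ψ X (stdVec j) = D X + D (reflect d X) * m X + b X := by
    intro X
    have e1 : HasFDerivAt (fun X => (φ X : ℂ)) (Complex.ofRealCLM.comp (fderiv ℝ φ X)) X :=
      Complex.ofRealCLM.hasFDerivAt.comp X (hφ1.differentiable one_ne_zero X).hasFDerivAt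
    have e2 : HasFDerivAt φr ((Complex.ofRealCLM.comp (fderiv ℝ φ (reflect d X))).comp
        ((reflect d : Space d ≃L[ℝ] Space d) : Space d →L[ℝ] Space d)) X := by
      have e0 : HasFDerivAt (fun X => (φ X : ℂ))
          (Complex.ofRealCLM.comp (fderiv ℝ φ (reflect d X))) (reflect d X) :=
        Complex.ofRealCLM.hasFDerivAt.comp _ (hφ1.differentiable one_ne_zero _).hasFDerivAt
      exact e0.comp X (reflect d : Space d ≃L[ℝ] Space d).hasFDerivAt
    have e3 := (hm.differentiable one_ne_zero X).hasFDerivAt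
    have e4 := (e1.add (e2.mul (e3.const_mul (reflectSign j : ℂ)))).fderiv
    have e5 : fderiv ℝ φ (reflect d X) (reflect d (stdVec j)) = reflectSign j * D (reflect d X) := by
      rw [reflect_stdVec, map_smul, smul_eq_mul]
    have e6 : (reflectSign j : ℂ) * reflectSign j = 1 := by
      exact_mod_cast reflectSign_mul_self j
    refine (congrArg (fun l => l (stdVec j)) e4).trans ?_
    simp only [add_apply, ContinuousLinearMap.comp_apply,
      smul_apply, Complex.ofRealCLM_apply, smul_eq_mul,
      ContinuousLinearEquiv.coe_coe]
    simp only [LinearIsometryEquiv.coe_toContinuousLinearEquiv, e5, hD, b]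
    push_cast
    linear_combination ((fderiv ℝ φ (reflect d X) (stdVec j) : ℝ) : ℂ) * m X * e6
  -- In the normal direction the sign is `-1`, so the two halves cancel on the boundary because `m =
  -- 1` there.
  have hψ0 : j = Fin.last d → ∀ X, height X = 0 → ψ X = 0 := by
    rintro rfl X hX
    simp [ψ, φr, reflect_eq_self hX, hm1 X hX, reflectSign]
  have key := hG.integral_upperHalfSpace_mul hUl hU hGi hψ hψs j hψ0
  rw [integral_eq_integral_add_reflect (hVl.integrable_smul_left_of_hasCompactSupport hDc hDs),
    integral_eq_integral_add_reflect
      (hGlj.integrable_smul_left_of_hasCompactSupport hφ.continuous hc)]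
  have i1 : IntegrableOn (fun X => fderiv ℝ ψ X (stdVec j) * U X) (upperHalfSpace d) :=
    integrableOn_upperHalfSpace_smul ((hψ.continuous_fderiv one_ne_zero).clm_apply continuous_const)
      (hψs.fderiv_apply ℝ (stdVec j)) hU
  have i2 : IntegrableOn (fun X => b X * U X) (upperHalfSpace d) :=
    integrableOn_upperHalfSpace_smul hb hbs hU
  have i3 : IntegrableOn (fun X => ψ X * G X j) (upperHalfSpace d) :=
    integrableOn_upperHalfSpace_smul hψ.continuous hψs hGj
  have l1 : ∫ X in upperHalfSpace d, (D X • reflectExtend m U X +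
      D (reflect d X) • reflectExtend m U (reflect d X)) =
      ∫ X in upperHalfSpace d, (fderiv ℝ ψ X (stdVec j) * U X - b X * U X) := by
    refine setIntegral_congr_fun hH fun X hX => ?_
    simp only [reflectExtend_of_pos (show 0 < height X from hX),
      reflectExtend_reflect (show 0 < height X from hX), Complex.real_smul, hdψ]
    ring
  have l2 : ∫ X in upperHalfSpace d, (φ X • reflectExtendGrad m U G X j +
      φ (reflect d X) • reflectExtendGrad m U G (reflect d X) j) =
      ∫ X in upperHalfSpace d, (ψ X * G X j + b X * U X) := by
    refine setIntegral_congr_fun hH fun X hX => ?_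
    simp only [reflectExtendGrad_of_pos (show 0 < height X from hX),
      reflectExtendGrad_reflect (show 0 < height X from hX), Complex.real_smul, ψ, b, φr]
    ring
  rw [l1, l2, integral_sub i1 i2, integral_add i3 i2, key]
  ring

end Extension

/-! ### Integrability up to the boundary from the weighted energy. -/

theorem integrableOn_height_rpow {d : ℕ} {α : ℝ} (hα : α < 1) (R : ℝ) :
    IntegrableOn (fun X : Space d => height X ^ (-α)) (upperHalfSpace d ∩ closedBall 0 R) := by
  -- The half-ball lies in the box `[-R, R]^d × (0, R]`, on which the function is a product of
  -- integrable functions of one variable.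
  let g : Fin (d + 1) → ℝ → ℝ := fun i =>
    if i = Fin.last d then (Ioc 0 R).indicator fun r => r ^ (-α) else (Icc (-R) R).indicator 1
  have hg : ∀ i, Integrable (g i) := by
    intro i
    simp only [g]
    split_ifs
    · rw [integrable_indicator_iff measurableSet_Ioc]
      rcases le_or_gt 0 R with hR | hR
      · exact (intervalIntegrable_iff_integrableOn_Ioc_of_le hR).1
          (intervalIntegral.intervalIntegrable_rpow' (by linarith))
      · rw [Ioc_eq_empty (by linarith)]
        exact integrableOn_empty
    · rw [integrable_indicator_iff measurableSet_Icc]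
      exact integrableOn_const (by simp) (by simp)
  have h1 : Integrable (fun x : Fin (d + 1) → ℝ => ∏ i, g i (x i)) :=
    Integrable.fintype_prod_dep (μ := fun _ => volume) hg
  have h2 : Integrable (fun X : Space d => ∏ i, g i (X i)) :=
    (PiLp.volume_preserving_ofLp (Fin (d + 1))).integrable_comp_of_integrable h1
  refine h2.integrableOn.congr_fun (fun X hX => ?_)
    ((isOpen_upperHalfSpace d).measurableSet.inter measurableSet_closedBall)
  have hXi : ∀ i, |X i| ≤ R := fun i =>
    (PiLp.norm_apply_le X i).trans (by simpa using hX.2)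
  have hpos : 0 < X (Fin.last d) := hX.1
  have e : ∀ i, g i (X i) = if i = Fin.last d then height X ^ (-α) else 1 := by
    intro i
    simp only [g]
    split_ifs with hi
    · subst hi
      have hmem : X (Fin.last d) ∈ Ioc 0 R := ⟨hpos, (le_abs_self _).trans (hXi _)⟩
      rw [indicator_of_mem hmem]
      rfl
    · have hmem : X i ∈ Icc (-R) R := abs_le.1 (hXi i)
      rw [indicator_of_mem hmem, Pi.one_apply]
  simp [e]

/-- A pointwise substitute for Hölder's inequality that also covers `p = 1`. Either `a ≤ t ^ (-α)`,
or `a ^ p * t ^ γ` is at least `a * t ^ (γ - α * (p - 1))`, whose exponent of `t` is nonpositive, so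
that `t ≤ R` bounds it below. -/
theorem le_weighted_rpow_add {p γ α : ℝ} (hp : 1 ≤ p) (h : γ ≤ α * (p - 1)) {R t a : ℝ} (ht : 0 < t)
    (htR : t ≤ R) (ha : 0 ≤ a) :
    a ≤ R ^ (α * (p - 1) - γ) * (a ^ p * t ^ γ) + t ^ (-α) := by
  have hR : 0 < R := ht.trans_le htR
  rcases le_or_gt a (t ^ (-α)) with h1 | h1
  · have : 0 ≤ R ^ (α * (p - 1) - γ) * (a ^ p * t ^ γ) := by positivity
    linarith
  · have ha0 : 0 < a := (Real.rpow_pos_of_pos ht _).trans h1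
    have h2 : t ^ (-α * (p - 1)) ≤ a ^ (p - 1) := by
      rw [Real.rpow_mul ht.le]
      exact Real.rpow_le_rpow (by positivity) h1.le (by linarith)
    have h3 : a ^ p = a * a ^ (p - 1) := by
      rw [← Real.rpow_one_add' ha (by linarith)]
      congr 1; ring
    have h4 : R ^ (γ - α * (p - 1)) ≤ t ^ (γ - α * (p - 1)) :=
      Real.rpow_le_rpow_of_nonpos ht htR (by linarith)
    have h5 : a ≤ R ^ (α * (p - 1) - γ) * (a ^ p * t ^ γ) := by
      calc a = R ^ (α * (p - 1) - γ) * (a * R ^ (γ - α * (p - 1))) := by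
            rw [mul_left_comm, ← Real.rpow_add hR]
            simp
        _ ≤ R ^ (α * (p - 1) - γ) * (a * t ^ (γ - α * (p - 1))) := by gcongr
        _ = R ^ (α * (p - 1) - γ) * (a * t ^ (-α * (p - 1)) * t ^ γ) := by
            rw [mul_assoc, ← Real.rpow_add ht]
            ring_nf
        _ ≤ R ^ (α * (p - 1) - γ) * (a ^ p * t ^ γ) := by
            rw [h3]
            gcongr
    have : 0 ≤ t ^ (-α) := by positivity
    linarith

/-- A function with finite weighted `p`-energy is integrable up to the boundary. -/
theorem integrableOn_of_weighted {d : ℕ} {p γ : ℝ} (hp : 1 ≤ p) (hγp : γ < p - 1) {E : Type*}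
    [NormedAddCommGroup E] {F : Space d → E} {R : ℝ}
    (hF : AEStronglyMeasurable F (volume.restrict (upperHalfSpace d ∩ closedBall 0 R)))
    (h : ∫⁻ X in upperHalfSpace d, ENNReal.ofReal (‖F X‖ ^ p * |height X| ^ γ) < ⊤) :
    IntegrableOn F (upperHalfSpace d ∩ closedBall 0 R) := by
  have hS : MeasurableSet (upperHalfSpace d ∩ closedBall 0 R) :=
    (isOpen_upperHalfSpace d).measurableSet.inter measurableSet_closedBall
  -- Here `γ < p - 1` enters: `α < 1` makes `t ^ (-α)` integrable near `0`. The choice `α = 0`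
  -- avoids dividing by `p - 1 = 0`, since `p = 1` forces `γ < 0`.
  obtain ⟨α, hα, hαγ⟩ : ∃ α : ℝ, α < 1 ∧ γ ≤ α * (p - 1) := by
    rcases le_or_gt γ 0 with h0 | h0
    · exact ⟨0, one_pos, by linarith⟩
    · have hp1 : 0 < p - 1 := h0.trans hγp
      exact ⟨γ / (p - 1), (div_lt_one hp1).2 hγp, (div_mul_cancel₀ _ hp1.ne').ge⟩
  refine ⟨hF, ?_⟩
  have hw := (integrableOn_height_rpow (d := d) hα R).2
  have hb : ∀ X ∈ upperHalfSpace d ∩ closedBall 0 R, ‖F X‖ₑ ≤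
      ENNReal.ofReal (R ^ (α * (p - 1) - γ)) * ENNReal.ofReal (‖F X‖ ^ p * |height X| ^ γ) +
        ‖height X ^ (-α)‖ₑ := by
    intro X hX
    have hpos : 0 < height X := hX.1
    have hle : height X ≤ R := (le_abs_self _).trans
      ((PiLp.norm_apply_le X (Fin.last d)).trans (by simpa using hX.2))
    have hR : 0 < R := hpos.trans_le hle
    rw [Real.enorm_of_nonneg (by positivity), ← ENNReal.ofReal_mul (by positivity),
      ← ENNReal.ofReal_add (by positivity) (by positivity), ← ofReal_norm, abs_of_pos hpos]
    exact ENNReal.ofReal_le_ofReal (le_weighted_rpow_add hp hαγ hpos hle (norm_nonneg _))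
  have hmw : Measurable fun X : Space d => ‖height X ^ (-α)‖ₑ :=
    ((continuous_height.measurable).pow_const _).enorm
  calc ∫⁻ X in upperHalfSpace d ∩ closedBall 0 R, ‖F X‖ₑ
      ≤ ∫⁻ X in upperHalfSpace d ∩ closedBall 0 R,
          (ENNReal.ofReal (R ^ (α * (p - 1) - γ)) * ENNReal.ofReal (‖F X‖ ^ p * |height X| ^ γ) +
            ‖height X ^ (-α)‖ₑ) := setLIntegral_mono' hS hb
    _ = ENNReal.ofReal (R ^ (α * (p - 1) - γ)) * (∫⁻ X in upperHalfSpace d ∩ closedBall 0 R,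
          ENNReal.ofReal (‖F X‖ ^ p * |height X| ^ γ)) +
          ∫⁻ X in upperHalfSpace d ∩ closedBall 0 R, ‖height X ^ (-α)‖ₑ := by
      rw [lintegral_add_right _ hmw, lintegral_const_mul' _ _ ENNReal.ofReal_ne_top]
    _ < ⊤ := by
      refine ENNReal.add_lt_top.2 ⟨ENNReal.mul_lt_top ENNReal.ofReal_lt_top ?_, hw⟩
      exact (lintegral_mono_set inter_subset_left).trans_lt h

/-- The `j`-th component of a `1`-form. -/
def component {d : ℕ} (A : Space d → Space d [⋀^Fin 1]→L[ℝ] ℝ) (j : Fin (d + 1)) (X : Space d) : ℝ :=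
  A X fun _ => stdVec j

theorem contDiff_component {d : ℕ} {A : Space d → Space d [⋀^Fin 1]→L[ℝ] ℝ} (hA : ContDiff ℝ 1 A)
    (j : Fin (d + 1)) : ContDiff ℝ 1 (component A j) :=
  (ContinuousAlternatingMap.apply ℝ (Space d) ℝ (fun _ : Fin 1 => (stdVec j : Space d))).contDiff.comp
    hA

theorem hasWeakGradient_weakGradient {d : ℕ} {Ω : Set (Space d)} {U : Space d → ℂ}
    (h : MemW11loc Ω U) : HasWeakGradient Ω U (weakGradient Ω U) := by
  have h2 := h.2
  rw [weakGradient, dif_pos h2]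
  exact h2.choose_spec

section Integrability

variable {d : ℕ} {p γ : ℝ} {A : Space d → Space d [⋀^Fin 1]→L[ℝ] ℝ} {U : Space d → ℂ}

theorem MemMagneticSobolev.integrableOn (hp : 1 ≤ p) (hγp : γ < p - 1)
    (h : MemMagneticSobolev p γ A (upperHalfSpace d) U) (R : ℝ) :
    IntegrableOn U (upperHalfSpace d ∩ closedBall 0 R) := by
  refine integrableOn_of_weighted hp hγp
    (h.1.1.aestronglyMeasurable.mono_set inter_subset_left) (lt_of_le_of_lt ?_ h.2)
  refine lintegral_mono fun X => ENNReal.ofReal_le_ofReal ?_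
  gcongr
  rw [one_mul]
  exact le_add_of_nonneg_left (by positivity)

/-- The energy controls only `∇_A U`; subtracting `i A U`, with `A` bounded on balls, recovers `∇U`.
-/
theorem MemMagneticSobolev.integrableOn_weakGradient (hA : ContDiff ℝ 1 A) (hp : 1 ≤ p)
    (hγp : γ < p - 1) (h : MemMagneticSobolev p γ A (upperHalfSpace d) U) (R : ℝ) :
    IntegrableOn (weakGradient (upperHalfSpace d) U) (upperHalfSpace d ∩ closedBall 0 R) := by
  have hH := (isOpen_upperHalfSpace d).measurableSet
  have hU := h.integrableOn hp hγp R
  have hAU : IntegrableOn (fun X => (WithLp.toLp 2 fun j : Fin (d + 1) =>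
      Complex.I * ((A X fun _ => stdVec j : ℝ) : ℂ) * U X : CVec d))
      (upperHalfSpace d ∩ closedBall 0 R) := by
    refine Integrable.of_eval_piLp fun j => ?_
    exact integrableOn_continuous_mul hH (continuous_const.mul
      (Complex.continuous_ofReal.comp (contDiff_component hA j).continuous)) hU
  have hw := hasWeakGradient_weakGradient h.1
  have hm : AEStronglyMeasurable (covGradient A (upperHalfSpace d) U)
      (volume.restrict (upperHalfSpace d ∩ closedBall 0 R)) :=
    (hw.1.aestronglyMeasurable.mono_set inter_subset_left).add hAU.1
  have hc : IntegrableOn (covGradient A (upperHalfSpace d) U) (upperHalfSpace d ∩ closedBall 0 R) := by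
    refine integrableOn_of_weighted hp hγp hm (lt_of_le_of_lt ?_ h.2)
    refine lintegral_mono fun X => ENNReal.ofReal_le_ofReal ?_
    gcongr
    rw [one_mul]
    exact le_add_of_nonneg_right (by positivity)
  refine (hc.sub hAU).congr (Eventually.of_forall fun X => ?_)
  simp [covGradient]

end Integrability

/-! ### The gauge phase along vertical segments. -/

/-- Differentiation under an integral over a compact interval. -/
theorem hasFDerivAt_intervalIntegral_of_continuous {d : ℕ} {F : Space d → ℝ → ℝ}
    {F' : Space d → ℝ → Space d →L[ℝ] ℝ} {a b : ℝ}
    (hF : ∀ X, Continuous (F X)) (hF' : Continuous fun q : Space d × ℝ => F' q.1 q.2)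
    (hd : ∀ X s, HasFDerivAt (fun Y => F Y s) (F' X s) X) (X : Space d) :
    HasFDerivAt (fun Y => ∫ s in a..b, F Y s) (∫ s in a..b, F' X s) X := by
  obtain ⟨C, hC⟩ := ((isCompact_closedBall X 1).prod (isCompact_uIcc (a := a) (b := b))
    ).exists_bound_of_continuousOn hF'.continuousOn
  have hFX : Continuous (F' X) := hF'.comp (Continuous.prodMk_right X)
  refine intervalIntegral.hasFDerivAt_integral_of_dominated_of_fderiv_le (bound := fun _ => C)
    (closedBall_mem_nhds X one_pos)
    (Eventually.of_forall fun Y => (hF Y).aestronglyMeasurable)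
    ((hF X).intervalIntegrable _ _) hFX.aestronglyMeasurable
    (Eventually.of_forall fun s hs Y hY => hC (Y, s) ⟨hY, uIoc_subset_uIcc hs⟩)
    intervalIntegrable_const (Eventually.of_forall fun s _ Y _ => hd Y s)

/-- The linear map `(x, t) ↦ (x, s t)`. -/
def scaleHeight (d : ℕ) (s : ℝ) : Space d →L[ℝ] Space d :=
  ContinuousLinearMap.id ℝ (Space d) + (s - 1) • (heightL d).smulRight (stdVec (Fin.last d))

theorem scaleHeight_apply {d : ℕ} (s : ℝ) (X : Space d) :
    scaleHeight d s X = X + ((s - 1) * height X) • stdVec (Fin.last d) := by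
  simp [scaleHeight, heightL_apply, smul_smul]

theorem continuous_scaleHeight (d : ℕ) : Continuous (scaleHeight d) :=
  continuous_const.add ((continuous_id.sub continuous_const).smul continuous_const)

theorem scaleHeight_one {d : ℕ} (X : Space d) : scaleHeight d 1 X = X := by
  simp [scaleHeight_apply]

theorem scaleHeight_neg_one {d : ℕ} (X : Space d) : scaleHeight d (-1) X = reflect d X := by
  ext k
  rw [scaleHeight_apply, reflect_apply, reflectSign]
  split_ifs with hk
  · subst hk
    simp [stdVec, height]
    ring
  · simp [stdVec, hk]

theorem hasDerivAt_scaleHeight {d : ℕ} (X : Space d) (s : ℝ) :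
    HasDerivAt (fun s => scaleHeight d s X) (height X • stdVec (Fin.last d)) s := by
  simp_rw [scaleHeight_apply]
  simpa using ((((hasDerivAt_id s).sub_const 1).mul_const (height X)).smul_const
    (stdVec (Fin.last d) : Space d)).const_add X

theorem scaleHeight_stdVec_last {d : ℕ} (s : ℝ) :
    scaleHeight d s (stdVec (Fin.last d)) = s • stdVec (Fin.last d) := by
  rw [scaleHeight_apply, height_stdVec, if_pos rfl, mul_one, sub_smul, one_smul]
  abel

theorem scaleHeight_stdVec_of_ne {d : ℕ} (s : ℝ) {j : Fin (d + 1)} (hj : j ≠ Fin.last d) :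
    scaleHeight d s (stdVec j) = stdVec j := by
  rw [scaleHeight_apply, height_stdVec, if_neg hj, mul_zero, zero_smul, add_zero]

section Phase

variable {d : ℕ} {f : Space d → ℝ}

/-- The average `∫_{-1}^1 f (x, s t) ds`. -/
def verticalMean (f : Space d → ℝ) (X : Space d) : ℝ := ∫ s in (-1 : ℝ)..1, f (scaleHeight d s X)

theorem continuous_scaleHeight_uncurry :
    Continuous fun q : Space d × ℝ => scaleHeight d q.2 q.1 :=
  ((continuous_scaleHeight d).comp continuous_snd).clm_apply continuous_fst

theorem continuous_fderiv_scaleHeight (hf : ContDiff ℝ 1 f) :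
    Continuous fun q : Space d × ℝ =>
      (fderiv ℝ f (scaleHeight d q.2 q.1)).comp (scaleHeight d q.2) :=
  ((hf.continuous_fderiv one_ne_zero).comp continuous_scaleHeight_uncurry).clm_comp
    ((continuous_scaleHeight d).comp continuous_snd)

/-- Rescaling the segment `[-t, t]` to `[-1, 1]` makes the endpoints independent of the point, so
one differentiates under the integral sign only. -/
theorem hasFDerivAt_verticalMean (hf : ContDiff ℝ 1 f) (X : Space d) :
    HasFDerivAt (verticalMean f)
      (∫ s in (-1 : ℝ)..1, (fderiv ℝ f (scaleHeight d s X)).comp (scaleHeight d s)) X := by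
  refine hasFDerivAt_intervalIntegral_of_continuous (F := fun X s => f (scaleHeight d s X))
    (F' := fun X s => (fderiv ℝ f (scaleHeight d s X)).comp (scaleHeight d s))
    (fun Y => hf.continuous.comp ((continuous_scaleHeight d).clm_apply continuous_const))
    (continuous_fderiv_scaleHeight hf) (fun Y s => ?_) X
  exact (hf.differentiable one_ne_zero _).hasFDerivAt.comp Y (scaleHeight d s).hasFDerivAt

theorem contDiff_verticalMean (hf : ContDiff ℝ 1 f) : ContDiff ℝ 1 (verticalMean f) := by
  rw [contDiff_one_iff_fderiv]
  refine ⟨fun X => (hasFDerivAt_verticalMean hf X).differentiableAt, ?_⟩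
  rw [funext fun X => (hasFDerivAt_verticalMean hf X).fderiv]
  exact intervalIntegral.continuous_parametric_intervalIntegral_of_continuous'
    (f := fun X s => (fderiv ℝ f (scaleHeight d s X)).comp (scaleHeight d s))
    (continuous_fderiv_scaleHeight hf) (-1) 1

/-- The phase `∫_{-t}^t f (x, s) ds`. -/
def phase (f : Space d → ℝ) (X : Space d) : ℝ := height X * verticalMean f X

theorem contDiff_height : ContDiff ℝ 1 (height : Space d → ℝ) := (heightL d).contDiff

theorem contDiff_phase (hf : ContDiff ℝ 1 f) : ContDiff ℝ 1 (phase f) :=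
  contDiff_height.mul (contDiff_verticalMean hf)

theorem fderiv_phase (hf : ContDiff ℝ 1 f) (X Y : Space d) :
    fderiv ℝ (phase f) X Y = height Y * verticalMean f X +
      height X * ∫ s in (-1 : ℝ)..1, fderiv ℝ f (scaleHeight d s X) (scaleHeight d s Y) := by
  have h1 : HasFDerivAt (height : Space d → ℝ) (heightL d) X := (heightL d).hasFDerivAt
  have h2 := (h1.mul (hasFDerivAt_verticalMean hf X)).fderiv
  have hint : IntervalIntegrable
      (fun s => (fderiv ℝ f (scaleHeight d s X)).comp (scaleHeight d s)) volume (-1) 1 :=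
    ((continuous_fderiv_scaleHeight hf).comp (Continuous.prodMk_right X)).intervalIntegrable _ _
  refine (congrArg (fun l => l Y) h2).trans ?_
  simp only [add_apply, smul_apply, smul_eq_mul, heightL_apply,
    ContinuousLinearMap.intervalIntegral_apply hint, ContinuousLinearMap.comp_apply]
  ring

theorem continuous_fderiv_vertical (hf : ContDiff ℝ 1 f) (X Y : Space d) :
    Continuous fun s => fderiv ℝ f (scaleHeight d s X) Y :=
  ((hf.continuous_fderiv one_ne_zero).comp
    ((continuous_scaleHeight d).clm_apply continuous_const)).clm_apply continuous_const

theorem hasDerivAt_vertical (hf : ContDiff ℝ 1 f) (X : Space d) (s : ℝ) :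
    HasDerivAt (fun s => f (scaleHeight d s X))
      (height X * fderiv ℝ f (scaleHeight d s X) (stdVec (Fin.last d))) s := by
  have h := (hf.differentiable one_ne_zero (scaleHeight d s X)).hasFDerivAt.comp_hasDerivAt s
    (hasDerivAt_scaleHeight X s)
  rwa [map_smul, smul_eq_mul] at h

theorem sub_reflect_eq_integral (hf : ContDiff ℝ 1 f) (X : Space d) :
    f X - f (reflect d X) =
      height X * ∫ s in (-1 : ℝ)..1, fderiv ℝ f (scaleHeight d s X) (stdVec (Fin.last d)) := by
  have h := intervalIntegral.integral_eq_sub_of_hasDerivAt (a := -1) (b := 1)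
    (fun s _ => hasDerivAt_vertical hf X s)
    ((continuous_const.mul (continuous_fderiv_vertical hf X _)).intervalIntegrable _ _)
  rw [scaleHeight_one, scaleHeight_neg_one, intervalIntegral.integral_const_mul] at h
  exact h.symm

/-- The integrand of the normal derivative is `d/ds (s f(x, s t))`, and the values at `s = 1` and `s
= -1` give the two terms. -/
theorem fderiv_phase_last (hf : ContDiff ℝ 1 f) (X : Space d) :
    fderiv ℝ (phase f) X (stdVec (Fin.last d)) = f X + f (reflect d X) := by
  have hc1 : Continuous fun s => f (scaleHeight d s X) :=
    hf.continuous.comp ((continuous_scaleHeight d).clm_apply continuous_const)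
  have hc2 := continuous_fderiv_vertical hf X (stdVec (Fin.last d))
  have h := intervalIntegral.integral_eq_sub_of_hasDerivAt (a := -1) (b := 1)
    (fun s _ => (hasDerivAt_id s).mul (hasDerivAt_vertical hf X s))
    (((continuous_const.mul hc1).add
      (continuous_id.mul (continuous_const.mul hc2))).intervalIntegrable _ _)
  simp only [id, Pi.mul_apply, scaleHeight_one, scaleHeight_neg_one] at h
  rw [fderiv_phase hf, height_stdVec, if_pos rfl, one_mul, verticalMean]
  simp_rw [scaleHeight_stdVec_last, map_smul, smul_eq_mul]
  rw [← intervalIntegral.integral_const_mul, ← intervalIntegral.integral_add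
    (hc1.intervalIntegrable _ _) (Continuous.intervalIntegrable (by fun_prop) _ _)]
  refine Eq.trans (intervalIntegral.integral_congr fun s _ => ?_) (h.trans (by ring))
  ring

end Phase

/-! ### Exterior derivative and the error left by the phase. -/

/-- The exterior derivative of a `1`-form in terms of its components. -/
theorem extDeriv_stdVec {d : ℕ} {A : Space d → Space d [⋀^Fin 1]→L[ℝ] ℝ} (hA : ContDiff ℝ 1 A)
    (X : Space d) (j k : Fin (d + 1)) :
    extDeriv A X ![stdVec j, stdVec k] =
      fderiv ℝ (component A k) X (stdVec j) - fderiv ℝ (component A j) X (stdVec k) := by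
  rw [extDeriv_apply (hA.differentiable one_ne_zero X), Fin.sum_univ_two]
  have e0 : (fun Y => A Y (Fin.removeNth 0 ![(stdVec j : Space d), stdVec k])) = component A k := by
    funext Y
    refine congrArg (A Y) (funext fun i => ?_)
    fin_cases i; rfl
  have e1 : (fun Y => A Y (Fin.removeNth 1 ![(stdVec j : Space d), stdVec k])) = component A j := by
    funext Y
    refine congrArg (A Y) (funext fun i => ?_)
    fin_cases i; rfl
  rw [e0, e1]
  simp [sub_eq_add_neg]

theorem abs_fderiv_component_sub_le {d : ℕ} {A : Space d → Space d [⋀^Fin 1]→L[ℝ] ℝ}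
    (hA : ContDiff ℝ 1 A) {β : ℝ} (hβ : ∀ X, ‖extDeriv A X‖ ≤ β) (X : Space d) (j k : Fin (d + 1)) :
    |fderiv ℝ (component A k) X (stdVec j) - fderiv ℝ (component A j) X (stdVec k)| ≤ β := by
  rw [← extDeriv_stdVec hA, ← Real.norm_eq_abs]
  refine ((extDeriv A X).le_opNorm _).trans ?_
  simpa [Fin.prod_univ_two, stdVec] using hβ X

/-- The phase of the last component compensates the reflection of the `1`-form up to an error
controlled by the exterior derivative. -/
theorem abs_fderiv_phase_sub_le {d : ℕ} {A : Space d → Space d [⋀^Fin 1]→L[ℝ] ℝ}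
    (hA : ContDiff ℝ 1 A) {β : ℝ} (hβ : ∀ X, ‖extDeriv A X‖ ≤ β) (X : Space d) (j : Fin (d + 1)) :
    |fderiv ℝ (phase (component A (Fin.last d))) X (stdVec j) -
      (component A j X - reflectSign j * component A j (reflect d X))| ≤ 2 * β * |height X| := by
  have hβ0 : 0 ≤ β := (norm_nonneg _).trans (hβ X)
  have hn := contDiff_component hA (Fin.last d)
  have hj := contDiff_component hA j
  by_cases h : j = Fin.last d
  · subst h
    rw [fderiv_phase_last hn, reflectSign, if_pos rfl]
    simp only [neg_mul, one_mul, sub_neg_eq_add, sub_self, abs_zero]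
    positivity
  -- For tangential `j` both terms are integrals over the same vertical segment, and the difference
  -- of the integrands is `dA[e_j, e_n]`.
  · rw [reflectSign, if_neg h, one_mul, sub_reflect_eq_integral hj, fderiv_phase hn, height_stdVec,
      if_neg h, zero_mul, zero_add, ← mul_sub]
    simp_rw [scaleHeight_stdVec_of_ne _ h]
    rw [← intervalIntegral.integral_sub
      ((continuous_fderiv_vertical hn X _).intervalIntegrable _ _)
      ((continuous_fderiv_vertical hj X _).intervalIntegrable _ _), abs_mul, mul_comm]
    gcongr
    have := intervalIntegral.norm_integral_le_of_norm_le_const (a := (-1 : ℝ)) (b := 1) (C := β)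
      (f := fun s => fderiv ℝ (component A (Fin.last d)) (scaleHeight d s X) (stdVec j) -
        fderiv ℝ (component A j) (scaleHeight d s X) (stdVec (Fin.last d)))
      fun s _ => abs_fderiv_component_sub_le hA hβ _ _ _
    rw [Real.norm_eq_abs] at this
    refine this.trans (le_of_eq ?_)
    norm_num
    ring

/-! ### The damping factor and the magnetic multiplier. -/

/-- The real damping factor `1 / (1 + β t²)`. -/
def damping {d : ℕ} (β : ℝ) (X : Space d) : ℝ := (1 + β * height X ^ 2)⁻¹

section Damping

variable {d : ℕ} {β : ℝ}

theorem damping_pos (hβ : 0 ≤ β) (X : Space d) : 0 < damping β X := by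
  unfold damping; positivity

theorem damping_le_one (hβ : 0 ≤ β) (X : Space d) : damping β X ≤ 1 :=
  inv_le_one_of_one_le₀ (by nlinarith [mul_nonneg hβ (sq_nonneg (height X))])

/-- This is `√β (1 - √β |t|)² ≥ 0` expanded. It turns the phase error `2 β |t|` into the bounded
error `√β`. -/
theorem damping_mul_le (hβ : 0 ≤ β) (X : Space d) :
    damping β X * (2 * β * |height X|) ≤ √β := by
  have h0 : 0 < 1 + β * height X ^ 2 := by positivity
  rw [damping, inv_mul_le_iff₀ h0]
  have h1 : √β ^ 2 = β := Real.sq_sqrt hβ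
  have h2 : 0 ≤ √β * (1 - √β * |height X|) ^ 2 := by positivity
  have h3 : |height X| ^ 2 = height X ^ 2 := sq_abs _
  have h4 : √β * (1 - √β * |height X|) ^ 2 =
      √β - 2 * √β ^ 2 * |height X| + √β * √β ^ 2 * |height X| ^ 2 := by ring
  rw [h4, h1, h3] at h2
  linarith

theorem contDiff_damping (hβ : 0 ≤ β) : ContDiff ℝ 1 (damping β : Space d → ℝ) :=
  (contDiff_const.add (contDiff_const.mul (contDiff_height.pow 2))).inv fun X => by positivity

theorem abs_fderiv_damping_le (hβ : 0 ≤ β) (X : Space d) (j : Fin (d + 1)) :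
    |fderiv ℝ (damping β) X (stdVec j)| ≤ √β := by
  have h1 : HasFDerivAt (height : Space d → ℝ) (heightL d) X := (heightL d).hasFDerivAt
  have h0 : (1 + β * height X ^ 2) ≠ 0 := by positivity
  have h2 := (hasDerivAt_inv h0).comp_hasFDerivAt X (((h1.pow 2).const_mul β).const_add 1)
  have h3 : fderiv ℝ (damping β) X (stdVec j) =
      -(damping β X * (damping β X * (2 * β * height X))) * height (stdVec j : Space d) := by
    refine (congrArg (fun l => l (stdVec j)) h2.fderiv).trans ?_
    simp only [smul_apply, smul_eq_mul, heightL_apply, damping]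
    field_simp
    simp
    ring
  have h4 := damping_mul_le hβ X
  have h5 := (damping_pos hβ X).le
  have h6 : |height (stdVec j : Space d)| ≤ 1 := by
    rw [height_stdVec]; split_ifs <;> simp
  have h7 : 0 ≤ damping β X * (2 * β * |height X|) := by positivity
  rw [h3, abs_mul, abs_neg, abs_mul, abs_mul, abs_mul, abs_of_nonneg h5,
    abs_of_nonneg (show 0 ≤ 2 * β by positivity)]
  calc damping β X * (damping β X * (2 * β * |height X|)) * |height (stdVec j : Space d)|
      ≤ 1 * (damping β X * (2 * β * |height X|)) * 1 := by
        gcongr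
        exact damping_le_one hβ X
    _ ≤ √β := by linarith

end Damping

/-- The multiplier of the reflected function: the phase of the last component of the form, damped
away from the boundary. -/
def magneticMultiplier {d : ℕ} (β : ℝ) (A : Space d → Space d [⋀^Fin 1]→L[ℝ] ℝ) (X : Space d) : ℂ :=
  (damping β X : ℂ) * Complex.exp (phase (component A (Fin.last d)) X * Complex.I)

section Multiplier

variable {d : ℕ} {β : ℝ} {A : Space d → Space d [⋀^Fin 1]→L[ℝ] ℝ}

theorem contDiff_magneticMultiplier (hβ : 0 ≤ β) (hA : ContDiff ℝ 1 A) :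
    ContDiff ℝ 1 (magneticMultiplier β A) :=
  (Complex.ofRealCLM.contDiff.comp (contDiff_damping hβ)).mul
    (((Complex.ofRealCLM.contDiff.comp (contDiff_phase (contDiff_component hA _))).mul
      contDiff_const).cexp)

theorem magneticMultiplier_eq_one {X : Space d} (hX : height X = 0) :
    magneticMultiplier β A X = 1 := by
  simp [magneticMultiplier, damping, phase, hX]

theorem norm_magneticMultiplier_le (hβ : 0 ≤ β) (X : Space d) : ‖magneticMultiplier β A X‖ ≤ 1 := by
  rw [magneticMultiplier, norm_mul, Complex.norm_exp_ofReal_mul_I, mul_one, Complex.norm_real,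
    Real.norm_of_nonneg (damping_pos hβ X).le]
  exact damping_le_one hβ X

theorem fderiv_magneticMultiplier (hβ : 0 ≤ β) (hA : ContDiff ℝ 1 A) (X Y : Space d) :
    fderiv ℝ (magneticMultiplier β A) X Y =
      ((fderiv ℝ (damping β) X Y : ℝ) + Complex.I * damping β X *
        (fderiv ℝ (phase (component A (Fin.last d))) X Y : ℝ)) *
      Complex.exp (phase (component A (Fin.last d)) X * Complex.I) := by
  have h1 : HasFDerivAt (fun X : Space d => (damping β X : ℂ))
      (Complex.ofRealCLM.comp (fderiv ℝ (damping β) X)) X :=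
    Complex.ofRealCLM.hasFDerivAt.comp X
      ((contDiff_damping hβ).differentiable one_ne_zero X).hasFDerivAt
  have h2 : HasFDerivAt (fun X : Space d => (phase (component A (Fin.last d)) X : ℂ))
      (Complex.ofRealCLM.comp (fderiv ℝ (phase (component A (Fin.last d))) X)) X :=
    Complex.ofRealCLM.hasFDerivAt.comp X
      ((contDiff_phase (contDiff_component hA _)).differentiable one_ne_zero X).hasFDerivAt
  refine (congrArg (fun l => l Y) (h1.mul (h2.mul_const Complex.I).cexp).fderiv).trans ?_
  simp only [add_apply, smul_apply, smul_eq_mul, ContinuousLinearMap.comp_apply,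
    Complex.ofRealCLM_apply]
  ring

/-- Componentwise bound for the covariant gradient of the reflected function. -/
theorem norm_reflected_component_le (hA : ContDiff ℝ 1 A) (hβ : ∀ X, ‖extDeriv A X‖ ≤ β)
    (X : Space d) (j : Fin (d + 1)) (g u : ℂ) :
    ‖(reflectSign j : ℂ) * (magneticMultiplier β A X * g +
        fderiv ℝ (magneticMultiplier β A) X (stdVec j) * u) +
      Complex.I * (component A j (reflect d X) : ℝ) * (magneticMultiplier β A X * u)‖ ≤
      ‖g + Complex.I * (component A j X : ℝ) * u‖ + 2 * √β * ‖u‖ := by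
  have hβ0 : 0 ≤ β := (norm_nonneg _).trans (hβ X)
  set e := Complex.exp (phase (component A (Fin.last d)) X * Complex.I) with he
  set θ := fderiv ℝ (phase (component A (Fin.last d))) X (stdVec j) with hθ
  set D := fderiv ℝ (damping β) X (stdVec j) with hD
  set δ := θ - (component A j X - reflectSign j * component A j (reflect d X)) with hδ
  have hs : (reflectSign j : ℂ) * reflectSign j = 1 := by exact_mod_cast reflectSign_mul_self j
  -- Up to a unimodular factor, the reflected component is the damped original one plus two errors
  -- in `u`: the derivative of the damping, and the damped phase error `δ`. Each is at most `√β`.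
  have key : (reflectSign j : ℂ) * (magneticMultiplier β A X * g +
        fderiv ℝ (magneticMultiplier β A) X (stdVec j) * u) +
      Complex.I * (component A j (reflect d X) : ℝ) * (magneticMultiplier β A X * u) =
      (reflectSign j : ℂ) * e * (damping β X * (g + Complex.I * (component A j X : ℝ) * u) +
        ((D : ℂ) + Complex.I * ((damping β X * δ : ℝ) : ℂ)) * u) := by
    rw [fderiv_magneticMultiplier hβ0 hA, magneticMultiplier, ← he, ← hθ, ← hD, hδ]
    push_cast
    linear_combination (-Complex.I * (component A j (reflect d X) : ℝ) * (damping β X) * e * u) * hs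
  have hn : ‖(reflectSign j : ℂ) * e‖ = 1 := by
    rw [norm_mul, he, Complex.norm_exp_ofReal_mul_I, mul_one, Complex.norm_real, Real.norm_eq_abs,
      abs_reflectSign]
  have hd0 := (damping_pos hβ0 X).le
  have hb : |damping β X * δ| ≤ √β := by
    rw [abs_mul, abs_of_nonneg hd0]
    refine le_trans ?_ (damping_mul_le hβ0 X)
    gcongr
    exact abs_fderiv_phase_sub_le hA hβ X j
  rw [key, norm_mul, hn, one_mul]
  refine (norm_add_le _ _).trans (add_le_add ?_ ?_)
  · rw [norm_mul, Complex.norm_real, Real.norm_of_nonneg hd0]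
    exact mul_le_of_le_one_left (norm_nonneg _) (damping_le_one hβ0 X)
  · rw [norm_mul]
    gcongr
    refine (norm_add_le _ _).trans ?_
    rw [norm_mul, Complex.norm_I, one_mul, Complex.norm_real, Complex.norm_real, Real.norm_eq_abs,
      Real.norm_eq_abs]
    linarith [abs_fderiv_damping_le hβ0 X j]

end Multiplier

/-! ### From componentwise bounds to the energy estimate. -/

theorem norm_le_of_components {d : ℕ} {v w : CVec d} {c : ℝ} (hc : 0 ≤ c)
    (h : ∀ j, ‖v j‖ ≤ ‖w j‖ + c) : ‖v‖ ≤ (d + 1) * (‖w‖ + c) := by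
  have h1 : ∀ j, ‖v j‖ ≤ ‖w‖ + c := fun j => (h j).trans (by gcongr; exact PiLp.norm_apply_le w j)
  rw [EuclideanSpace.norm_eq]
  refine Real.sqrt_le_iff.2 ⟨by positivity, ?_⟩
  calc ∑ j, ‖v j‖ ^ 2 ≤ ∑ _j : Fin (d + 1), (‖w‖ + c) ^ 2 :=
        Finset.sum_le_sum fun j _ => pow_le_pow_left₀ (norm_nonneg _) (h1 j) 2
    _ = ((d : ℝ) + 1) * (‖w‖ + c) ^ 2 := by simp
    _ ≤ ((d : ℝ) + 1) ^ 2 * (‖w‖ + c) ^ 2 := by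
        gcongr
        nlinarith [(Nat.cast_nonneg d : (0 : ℝ) ≤ d)]
    _ = (((d : ℝ) + 1) * (‖w‖ + c)) ^ 2 := by ring

theorem add_rpow_le_two_rpow_mul {p x y : ℝ} (hp : 0 ≤ p) (hx : 0 ≤ x) (hy : 0 ≤ y) :
    (x + y) ^ p ≤ 2 ^ p * (x ^ p + y ^ p) := by
  have h : (x + y) ^ p ≤ (2 * max x y) ^ p := by
    gcongr
    linarith [le_max_left x y, le_max_right x y]
  refine h.trans ?_
  rw [Real.mul_rpow (by norm_num) (le_max_of_le_left hx)]
  gcongr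
  rcases max_cases x y with ⟨e, _⟩ | ⟨e, _⟩ <;> rw [e]
  · exact le_add_of_nonneg_right (by positivity)
  · exact le_add_of_nonneg_left (by positivity)

/-- The constant in the energy estimate for the reflected function. -/
def reflectConst (d : ℕ) (p L : ℝ) : ℝ :=
  ((d : ℝ) + 1) ^ p * 2 ^ p * (1 + 2 ^ p * L) + 1

/-- In the constant, `(d + 1) ^ p` comes from passing to components, the first `2 ^ p` from
splitting the power of a sum, `2 ^ p * L` from `(2 √β) ^ p`, and the final `1` from the zero-order
term. -/
theorem energy_density_le {d : ℕ} {p β κ L : ℝ} (hp : 1 ≤ p) (hβ : 0 ≤ β) (hκ : 0 ≤ κ) (hL : 0 ≤ L)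
    (h : β ^ (p / 2) ≤ L * κ) {v w : CVec d} {u u' : ℂ} (hu : ‖u'‖ ≤ ‖u‖)
    (hv : ∀ j, ‖v j‖ ≤ ‖w j‖ + 2 * √β * ‖u‖) :
    ‖v‖ ^ p + κ * ‖u'‖ ^ p ≤ reflectConst d p L * (‖w‖ ^ p + κ * ‖u‖ ^ p) := by
  have hp0 : 0 ≤ p := by linarith
  have h1 := norm_le_of_components (by positivity) hv
  have h2 : ‖v‖ ^ p ≤ ((d : ℝ) + 1) ^ p * (2 ^ p * (‖w‖ ^ p + 2 ^ p * (L * κ) * ‖u‖ ^ p)) := by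
    refine (Real.rpow_le_rpow (norm_nonneg _) h1 hp0).trans ?_
    rw [Real.mul_rpow (by positivity) (by positivity)]
    gcongr
    refine (add_rpow_le_two_rpow_mul hp0 (norm_nonneg _) (by positivity)).trans ?_
    gcongr
    rw [Real.mul_rpow (by positivity) (norm_nonneg _), Real.mul_rpow (by norm_num) (by positivity),
      Real.sqrt_eq_rpow, ← Real.rpow_mul hβ, one_div_mul_eq_div]
    gcongr
  have h3 : ‖u'‖ ^ p ≤ ‖u‖ ^ p := Real.rpow_le_rpow (norm_nonneg _) hu hp0
  have h4 : κ * ‖u'‖ ^ p ≤ κ * ‖u‖ ^ p := by gcongr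
  have hw : 0 ≤ ‖w‖ ^ p := by positivity
  have hκu : 0 ≤ κ * ‖u‖ ^ p := by positivity
  have e : reflectConst d p L * (‖w‖ ^ p + κ * ‖u‖ ^ p) =
      ((d : ℝ) + 1) ^ p * (2 ^ p * (‖w‖ ^ p + 2 ^ p * (L * κ) * ‖u‖ ^ p)) + κ * ‖u‖ ^ p +
      (((d : ℝ) + 1) ^ p * 2 ^ p * (2 ^ p * L) * ‖w‖ ^ p +
        ((d : ℝ) + 1) ^ p * 2 ^ p * (κ * ‖u‖ ^ p) + ‖w‖ ^ p) := by
    rw [reflectConst]; ring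
  rw [e]
  have : 0 ≤ ((d : ℝ) + 1) ^ p * 2 ^ p * (2 ^ p * L) * ‖w‖ ^ p +
      ((d : ℝ) + 1) ^ p * 2 ^ p * (κ * ‖u‖ ^ p) + ‖w‖ ^ p := by positivity
  linarith

section Energy

variable {d : ℕ} {p γ β : ℝ} {A : Space d → Space d [⋀^Fin 1]→L[ℝ] ℝ} {U : Space d → ℂ}

/-- The magnetic extension of `U` to the whole space. -/
def magneticExtend (β : ℝ) (A : Space d → Space d [⋀^Fin 1]→L[ℝ] ℝ) (U : Space d → ℂ) :
    Space d → ℂ :=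
  reflectExtend (magneticMultiplier β A) U

theorem memW11loc_magneticExtend (hp : 1 ≤ p) (hγp : γ < p - 1) (hA : ContDiff ℝ 1 A) (hβ : 0 ≤ β)
    (hU : MemMagneticSobolev p γ A (upperHalfSpace d) U) :
    LocallyIntegrable (magneticExtend β A U) ∧
      HasWeakGradient univ (magneticExtend β A U)
        (reflectExtendGrad (magneticMultiplier β A) U (weakGradient (upperHalfSpace d) U)) :=
  have hm := contDiff_magneticMultiplier hβ hA
  have hUi := hU.integrableOn hp hγp
  ⟨locallyIntegrable_reflectExtend hm.continuous hUi,
    hasWeakGradient_reflectExtend hm (fun _ hX => magneticMultiplier_eq_one hX) hU.1.1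
      (hasWeakGradient_weakGradient hU.1) hUi (hU.integrableOn_weakGradient hA hp hγp)⟩

/-- The coefficient `κ` is kept separate from the `β` of the multiplier, so that the estimate serves
both for membership in the space (`κ = 1`) and for every larger field bound, without changing the
extension. -/
theorem energy_magneticExtend_le {κ L : ℝ} (hp : 1 ≤ p) (hγp : γ < p - 1) (hA : ContDiff ℝ 1 A)
    (hβ : ∀ X, ‖extDeriv A X‖ ≤ β) (hκ : 0 ≤ κ) (hL : 0 ≤ L) (h : β ^ (p / 2) ≤ L * κ)
    (hU : MemMagneticSobolev p γ A (upperHalfSpace d) U) :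
    energy p γ κ A univ (magneticExtend β A U) ≤
      ENNReal.ofReal (1 + reflectConst d p L) * energy p γ κ A (upperHalfSpace d) U := by
  have hβ0 : 0 ≤ β := (norm_nonneg _).trans (hβ 0)
  have hH := (isOpen_upperHalfSpace d).measurableSet
  obtain ⟨hVl, hVG⟩ := memW11loc_magneticExtend hp hγp hA hβ0 hU
  set m := magneticMultiplier β A with hm
  set V := magneticExtend β A U with hV
  set G := weakGradient (upperHalfSpace d) U with hG
  -- `weakGradient` is an arbitrary choice; almost everywhere it is the explicit gradient of the
  -- extension.
  have hae := (hasWeakGradient_weakGradient ⟨hVl.locallyIntegrableOn _, _, hVG⟩).ae_eq isOpen_univ hVG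
  have hC : 0 ≤ reflectConst d p L := by unfold reflectConst; positivity
  let E : Space d → CVec d := fun X => reflectExtendGrad m U G X +
    WithLp.toLp 2 (fun j : Fin (d + 1) => Complex.I * ((A X (fun _ => stdVec j) : ℝ) : ℂ) * V X)
  have e1 : energy p γ κ A univ V =
      ∫⁻ X, ENNReal.ofReal ((‖E X‖ ^ p + κ * ‖V X‖ ^ p) * |height X| ^ γ) := by
    rw [energy, Measure.restrict_univ]
    rw [Measure.restrict_univ] at hae
    refine lintegral_congr_ae ?_
    filter_upwards [hae] with X hX
    rw [covGradient, hX]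
  rw [e1, lintegral_eq_lintegral_add_reflect, ENNReal.ofReal_add zero_le_one hC, ENNReal.ofReal_one,
    add_mul, one_mul]
  refine add_le_add (le_of_eq (setLIntegral_congr_fun hH fun X hX => ?_)) ?_
  · have hX' : 0 < height X := hX
    have hVX : V X = U X := reflectExtend_of_pos hX'
    simp only [E, covGradient, reflectExtendGrad_of_pos hX', hVX, hG]
  · rw [energy, ← lintegral_const_mul' _ _ ENNReal.ofReal_ne_top]
    refine setLIntegral_mono' hH fun X hX => ?_
    have hX' : 0 < height X := hX
    have hVX : V (reflect d X) = m X * U X := reflectExtend_reflect hX'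
    rw [← ENNReal.ofReal_mul hC, height_reflect, abs_neg, ← mul_assoc]
    refine ENNReal.ofReal_le_ofReal (mul_le_mul_of_nonneg_right ?_ (by positivity))
    refine energy_density_le hp hβ0 hκ hL h ?_ fun j => ?_
    · rw [hVX, norm_mul]
      exact mul_le_of_le_one_left (norm_nonneg _) (norm_magneticMultiplier_le hβ0 X)
    · have := norm_reflected_component_le hA hβ X j (G X j) (U X)
      simp only [E, covGradient, PiLp.add_apply, reflectExtendGrad_reflect hX', hVX]
      exact this

end Energy

end MagneticSobolev

end

theorem mainTheorem6 (d : ℕ) (hd : 1 ≤ d) (p γ : ℝ) (hp : 1 ≤ p) (hγ : -1 < γ) (hγp : γ < p - 1) :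
    ∃ C : ℝ, 0 < C ∧
      ∀ A : MagneticSobolev.Space d → MagneticSobolev.Space d [⋀^Fin 1]→L[ℝ] ℝ,
        ContDiff ℝ 1 A → (∃ M : ℝ, ∀ X, ‖extDeriv A X‖ ≤ M) →
        ∀ U : MagneticSobolev.Space d → ℂ,
          MagneticSobolev.MemMagneticSobolev p γ A (MagneticSobolev.upperHalfSpace d) U →
          ∃ V : MagneticSobolev.Space d → ℂ,
            MagneticSobolev.MemMagneticSobolev p γ A Set.univ V ∧
            (∀ X ∈ MagneticSobolev.upperHalfSpace d, V X = U X) ∧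
            ∀ β : ℝ, (∀ X, ‖extDeriv A X‖ ≤ β) →
              MagneticSobolev.energy p γ (β ^ (p / 2)) A Set.univ V ≤
                ENNReal.ofReal C *
                  MagneticSobolev.energy p γ (β ^ (p / 2)) A
                    (MagneticSobolev.upperHalfSpace d) U := by
  refine ⟨1 + MagneticSobolev.reflectConst d p 1, by
    unfold MagneticSobolev.reflectConst; positivity, ?_⟩
  rintro A hA ⟨M, hM⟩ U hU
  have hbdd : BddAbove (Set.range fun X => ‖extDeriv A X‖) := ⟨M, by rintro _ ⟨X, rfl⟩; exact hM X⟩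
  -- The extension is built with the smallest admissible bound, since it must not depend on `β`.
  set β₀ : ℝ := ⨆ X, ‖extDeriv A X‖ with hβ₀
  have hle : ∀ X, ‖extDeriv A X‖ ≤ β₀ := le_ciSup hbdd
  have h0 : 0 ≤ β₀ := (norm_nonneg _).trans (hle 0)
  obtain ⟨hVl, hVG⟩ := MagneticSobolev.memW11loc_magneticExtend hp hγp hA h0 hU
  refine ⟨MagneticSobolev.magneticExtend β₀ A U, ⟨⟨hVl.locallyIntegrableOn _, _, hVG⟩, ?_⟩,
    fun X hX => MagneticSobolev.reflectExtend_of_pos hX, fun β hβ => ?_⟩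
  -- With `κ = 1` the constant may depend on `A`, as only finiteness is at stake. In the second case
  -- `κ = β ^ (p / 2) ≥ β₀ ^ (p / 2)` allows `L = 1`, hence a constant independent of `A`.
  · refine lt_of_le_of_lt (MagneticSobolev.energy_magneticExtend_le hp hγp hA hle zero_le_one
      (L := β₀ ^ (p / 2)) (by positivity) (by rw [mul_one]) hU) ?_
    exact ENNReal.mul_lt_top ENNReal.ofReal_lt_top hU.2
  · have hβ0 : 0 ≤ β := (norm_nonneg _).trans (hβ 0)
    refine MagneticSobolev.energy_magneticExtend_le hp hγp hA hle (by positivity) zero_le_one ?_ hU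
    rw [one_mul]
    exact Real.rpow_le_rpow h0 (ciSup_le hβ) (by linarith)
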